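/- Consider a queue with infinite waiting room, Poisson arrivals of rate $\lambda>0$, and $K$ groups of parallel exponential servers; group $k$ has $M_k$ servers, each with service rate $\mu_k>0$ and operating cost rate $c_k\in\mathbb R$ while working. With $n$ customers in the system (including those in service) the holding cost rate is $h(n)$, where $h:\mathbb N\to\mathbb R$ is nondecreasing and convex and $h(n)\to\infty$. An efficient policy $d$ assigns to every $n\in\mathbb N$ numbers $d(n,k)\in\{0,\dots,M_k\}$ of working servers with $\|d(n)\|_1=\sum_k d(n,k)\le n$. Under $d$ the number of customers $n_t$ is the continuous-time Markov chain on $\mathbb N$ with birth rate $\lambda$ and death rate $\sum_k d(n,k)\mu_k$ in state $n$; let $B$ be its generator. The cost rate in state $n$ is $f(n)=h(n)+\sum_k d(n,k)c_k$, and the long-run average cost is $\eta^d=\lim_{T\to\infty}\frac1T\,\mathbb E\int_0^T f(n_t)\,dt$ (from every initial state). Let $d^*$ be an optimal policy, i.e. an efficient policy whose average cost $\eta^*$ is finite and minimal among all efficient policies. Let $g^*$ be its performance potential, i.e. a solution (unique up to an additive constant) of the Poisson equation $f-\eta^*\mathbf 1+Bg^*=0$ for $d^*$, and let $G^*(n)=g^*(n)-g^*(n-1)$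 for $n\ge1$. Then: (a) $\|d^*(n)\|_1\le\|d^*(n+1)\|_1$ for all $n\in\mathbb N$. (b) For every $n\ge1$, if $d^*(n,k)=0$ for every $k$ with $G^*(n)=c_k/\mu_k$ (in particular, if there is no such $k$), then $$\|d^*(n)\|_1=n\wedge\sum_{k\in\mathbb K^*_n}M_k,\qquad \mathbb K^*_n=\{k: G^*(n)>c_k/\mu_k\}.$$ (c) Without that convention on ties, for every $n\ge1$, $$n\wedge\sum_{k:\,G^*(n)>c_k/\mu_k}M_k\ \le\ \|d^*(n)\|_1\ \le\ n\wedge\sum_{k:\,G^*(n)\ge c_k/\mu_k}M_k .$$ -/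

import Mathlib

open Filter Topology

noncomputable section

/-- The data of a group-server queue with `K` groups of parallel exponential servers: Poisson
arrivals of rate `lam`; group `k` has `M k` servers, each of service rate `mu k` and of operating
cost rate `c k` while it works; `h n` is the holding cost rate with `n` customers present, a
(weakly) increasing convex function on `ℕ` that tends to infinity. -/
structure GroupServerQueue (K : ℕ) where
  lam : ℝ
  M : Fin K → ℕ
  mu : Fin K → ℝ
  c : Fin K → ℝ
  h : ℕ → ℝ
  lam_pos : 0 < lam
  mu_pos : ∀ k, 0 < mu k
  h_mono : Monotone h
  h_convex : ∀ n, h (n + 1) - h n ≤ h (n + 2) - h (n + 1)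
  h_tendsto : Tendsto h atTop atTop

namespace GroupServerQueue

variable {K : ℕ} (Q : GroupServerQueue K)

/-- The total number of working servers under the scheduling action `m`. -/
def total (m : Fin K → ℕ) : ℕ := ∑ k, m k

/-- The total service rate under the action `m`. -/
def rate (m : Fin K → ℕ) : ℝ := ∑ k, (m k : ℝ) * Q.mu k

/-- The cost rate `f (n, m)`: holding cost plus operating cost. -/
def cost (n : ℕ) (m : Fin K → ℕ) : ℝ := Q.h n + ∑ k, (m k : ℝ) * Q.c k

/-- A stationary policy `d : ℕ → (Fin K → ℕ)` is efficient if `d n k ≤ M k` and if at most `n`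
servers work in state `n`. -/
def IsEfficient (d : ℕ → Fin K → ℕ) : Prop :=
  ∀ n, (∀ k, d n k ≤ Q.M k) ∧ total (d n) ≤ n

/-- The infinitesimal generator of the number of customers under `d`, acting on functions:
a birth-death generator with birth rate `lam` and death rate `rate (d n)` in state `n`.
(In state `0` the term with the death rate vanishes.) -/
def gen (d : ℕ → Fin K → ℕ) (u : ℕ → ℝ) (n : ℕ) : ℝ :=
  Q.lam * (u (n + 1) - u n) + Q.rate (d n) * (u (n - 1) - u n)

/-- A uniform bound for the exit rates. -/
def unifRate : ℝ := Q.lam + ∑ k, (Q.M k : ℝ) * Q.mu k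

/-- The one-step operator `I + B / Λ` of the uniformized jump chain, where `B` is the generator
and `Λ` is `unifRate`. -/
def step (d : ℕ → Fin K → ℕ) (u : ℕ → ℝ) (n : ℕ) : ℝ :=
  u n + Q.gen d u n / Q.unifRate

/-- The transition probability `P (n_t = j | n_0 = i)` of the continuous-time Markov chain with the
(bounded) generator `B`, that is the `(i, j)` entry of
`exp (t B) = ∑ r, exp (- Λ t) * (Λ t) ^ r / r! * (I + B / Λ) ^ r`. -/
def transProb (d : ℕ → Fin K → ℕ) (t : ℝ) (i j : ℕ) : ℝ :=
  ∑' r : ℕ, Real.exp (-(Q.unifRate * t)) * (Q.unifRate * t) ^ r / (r.factorial : ℝ)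
    * ((Q.step d)^[r] (Pi.single j 1)) i

/-- The expected cost rate `E [f (n_t, d (n_t)) | n_0 = i]` at time `t`. -/
def expectedCost (d : ℕ → Fin K → ℕ) (t : ℝ) (i : ℕ) : ℝ :=
  ∑' j : ℕ, Q.transProb d t i j * Q.cost j (d j)

/-- The long-run average cost of `d` exists, is finite and equals `η`, from every initial
state: all expectations are finite and `(1 / T) * E ∫₀ᵀ f (n_t, d (n_t)) dt` tends to `η`. -/
def HasAverageCost (d : ℕ → Fin K → ℕ) (η : ℝ) : Prop :=
  ∀ i : ℕ,
    (∀ t : ℝ, 0 ≤ t → Summable fun j : ℕ => Q.transProb d t i j * Q.cost j (d j)) ∧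
    (∀ T : ℝ, 0 ≤ T →
      IntervalIntegrable (fun t => Q.expectedCost d t i) MeasureTheory.volume 0 T) ∧
    Tendsto (fun T : ℝ => 1 / T * ∫ t in (0 : ℝ)..T, Q.expectedCost d t i) atTop (𝓝 η)

/-- `d` is optimal: it is efficient, its long-run average cost is finite, and no efficient policy
has a smaller one. (The cost rate is bounded below, so a policy to which `HasAverageCost` gives
no value has infinite cost.) -/
def IsOptimal (d : ℕ → Fin K → ℕ) : Prop :=
  Q.IsEfficient d ∧ ∃ η, Q.HasAverageCost d η ∧
    ∀ d' η', Q.IsEfficient d' → Q.HasAverageCost d' η' → η ≤ η'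

/-- `g` is a performance potential (relative value function) of the policy `d` of average cost
`η`: a solution of the Poisson equation `f - η 1 + B g = 0`. Such a `g` exists and is unique up to
an additive constant, the free choice of `g 0`. -/
def IsPotential (d : ℕ → Fin K → ℕ) (η : ℝ) (g : ℕ → ℝ) : Prop :=
  ∀ n, Q.cost n (d n) - η + Q.gen d g n = 0

/-- The perturbation realization factor `G n = g n - g (n - 1)`, for `n ≥ 1`. (The value `0`
that this expression gives at `n = 0` plays no role: no server works in state `0`.) -/
def prf (g : ℕ → ℝ) (n : ℕ) : ℝ := g n - g (n - 1)

end GroupServerQueue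

end

/-! ### The uniformized jump chain -/

namespace GroupServerQueue

variable {K : ℕ} (Q : GroupServerQueue K) {d : ℕ → Fin K → ℕ}

/-! Everything rests on the optimality equation `λ G(n+1) = η - h(n) + max_m ∑ k, m k * (μ k * G(n)
- c k)`, over actions `m` feasible with `n` customers, and on strict growth of `G = prf g` from `n =
1` on. A maximizer uses no server with `c/μ > G(n)` and leaves no server with `c/μ < G(n)` idle
while a customer waits; this gives (c), and (b) once ties are excluded. By strict growth a group
that breaks even at `n + 1` is profitable at `n + 2`, so the upper bound of (c) at `n + 1` is at
most the lower bound at `n + 2`: this is (a).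

The optimality equation comes from policy improvement. As the cost rate tends to infinity, a finite
average cost forces positive recurrence above the last state `N` without service, with integrable
cost (`exists_summable_weight`). For a competitor that agrees with `d` outside finitely many states,
the Poisson residual summed against its invariant measure telescopes to total mass times `η' - η`,
the boundary term vanishing. A nonpositive, nonzero residual therefore lowers the cost
(`exists_lt_hasAverageCost`). Suitable competitors give `N = 0` and then maximality in each state
(`IsOptimal.maximal_and_strictMono`).

For strict growth (`strictMono_of_recursion`), a first failure would propagate to all later states,
by convexity of `h` and diminishing marginal gains (`maxGain_exchange`). Then `G`, hence the gain,
is bounded above, and `h → ∞` drives `G` to `-∞`; but `G` is eventually nonnegative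
(`eventually_nonneg_of_residual`). -/

theorem rate_nonneg (m : Fin K → ℕ) : 0 ≤ Q.rate m :=
  Finset.sum_nonneg fun k _ => mul_nonneg (Nat.cast_nonneg _) (Q.mu_pos k).le

theorem rate_mono {m m' : Fin K → ℕ} (h : ∀ k, m k ≤ m' k) : Q.rate m ≤ Q.rate m' :=
  Finset.sum_le_sum fun k _ =>
    mul_le_mul_of_nonneg_right (Nat.cast_le.2 (h k)) (Q.mu_pos k).le

theorem unifRate_pos : 0 < Q.unifRate :=
  add_pos_of_pos_of_nonneg Q.lam_pos (Q.rate_nonneg Q.M)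

theorem lam_add_rate_le (hd : Q.IsEfficient d) (n : ℕ) : Q.lam + Q.rate (d n) ≤ Q.unifRate :=
  add_le_add le_rfl (Q.rate_mono (hd n).1)

theorem IsEfficient.zero (hd : Q.IsEfficient d) : d 0 = 0 := by
  funext k
  have h := (hd 0).2
  have : d 0 k ≤ total (d 0) := Finset.single_le_sum (fun _ _ => Nat.zero_le _) (Finset.mem_univ k)
  simp only [Pi.zero_apply]
  omega

theorem IsEfficient.rate_zero (hd : Q.IsEfficient d) : Q.rate (d 0) = 0 := by
  simp [hd.zero, rate]

theorem step_eq (d : ℕ → Fin K → ℕ) (u : ℕ → ℝ) (n : ℕ) :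
    Q.step d u n = (1 - (Q.lam + Q.rate (d n)) / Q.unifRate) * u n
      + Q.lam / Q.unifRate * u (n + 1) + Q.rate (d n) / Q.unifRate * u (n - 1) := by
  have := Q.unifRate_pos.ne'
  simp only [step, gen]
  field_simp
  ring

theorem step_nonneg (hd : Q.IsEfficient d) {u : ℕ → ℝ} (hu : ∀ n, 0 ≤ u n) (n : ℕ) :
    0 ≤ Q.step d u n := by
  rw [step_eq]
  have h1 : (Q.lam + Q.rate (d n)) / Q.unifRate ≤ 1 :=
    (div_le_one Q.unifRate_pos).2 (Q.lam_add_rate_le hd n)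
  have h2 := div_nonneg Q.lam_pos.le Q.unifRate_pos.le
  have h3 := div_nonneg (Q.rate_nonneg (d n)) Q.unifRate_pos.le
  have := hu n
  have := hu (n + 1)
  have := hu (n - 1)
  have : 0 ≤ 1 - (Q.lam + Q.rate (d n)) / Q.unifRate := by linarith
  positivity

/-- The one-step operator as a linear map. -/
noncomputable def stepLin (d : ℕ → Fin K → ℕ) : (ℕ → ℝ) →ₗ[ℝ] (ℕ → ℝ) where
  toFun := Q.step d
  map_add' u v := by
    funext n
    simp only [step_eq, Pi.add_apply]
    ring
  map_smul' a u := by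
    funext n
    simp only [step_eq, Pi.smul_apply, smul_eq_mul, RingHom.id_apply]
    ring

theorem iterate_step (d : ℕ → Fin K → ℕ) (r : ℕ) (u : ℕ → ℝ) :
    (Q.step d)^[r] u = (Q.stepLin d ^ r) u :=
  (Module.End.pow_apply (Q.stepLin d) r u).symm

/-- The `r`-step transition probabilities of the uniformized jump chain. -/
noncomputable def jumpProb (d : ℕ → Fin K → ℕ) (r i j : ℕ) : ℝ := (Q.step d)^[r] (Pi.single j 1) i

theorem iterate_step_nonneg (hd : Q.IsEfficient d) {u : ℕ → ℝ} (hu : ∀ n, 0 ≤ u n) (r i : ℕ) :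
    0 ≤ (Q.step d)^[r] u i := by
  induction r generalizing i with
  | zero => exact hu i
  | succ r ih =>
    rw [Function.iterate_succ_apply']
    exact Q.step_nonneg hd ih i

theorem jumpProb_nonneg (hd : Q.IsEfficient d) (r i j : ℕ) : 0 ≤ Q.jumpProb d r i j := by
  refine Q.iterate_step_nonneg hd (fun n => ?_) r i
  by_cases h : n = j
  · subst h; simp
  · simp [h]

/-- Each row of the `r`-step matrix has finite support, so no summability of `u` is needed. -/
theorem hasSum_jumpProb_mul (d : ℕ → Fin K → ℕ) (u : ℕ → ℝ) (r i : ℕ) :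
    HasSum (fun j => Q.jumpProb d r i j * u j) ((Q.step d)^[r] u i) := by
  induction r generalizing i with
  | zero =>
    have := hasSum_single (f := fun j => Q.jumpProb d 0 i j * u j) i fun j hj => by
      simp [jumpProb, hj.symm]
    simpa [jumpProb] using this
  | succ r ih =>
    rw [Function.iterate_succ_apply', step_eq]
    refine ((((ih i).mul_left _).add ((ih (i + 1)).mul_left _)).add
      ((ih (i - 1)).mul_left _)).congr_fun ?_
    intro j
    simp only [jumpProb, Function.iterate_succ_apply', step_eq]
    ring

theorem iterate_step_one (d : ℕ → Fin K → ℕ) (r : ℕ) : (Q.step d)^[r] 1 = 1 := by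
  induction r with
  | zero => rfl
  | succ r ih =>
    rw [Function.iterate_succ_apply', ih]
    funext n
    simp [step, gen]

theorem hasSum_jumpProb (d : ℕ → Fin K → ℕ) (r i : ℕ) : HasSum (Q.jumpProb d r i) 1 := by
  have := Q.hasSum_jumpProb_mul d 1 r i
  rw [iterate_step_one] at this
  simpa using this

theorem jumpProb_le_one (hd : Q.IsEfficient d) (r i j : ℕ) : Q.jumpProb d r i j ≤ 1 :=
  le_hasSum (Q.hasSum_jumpProb d r i) j fun _ _ => Q.jumpProb_nonneg hd r i _

/-- The `r`-step probability to be in `{0, …, n}`. -/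
noncomputable def jumpCdf (d : ℕ → Fin K → ℕ) (r i n : ℕ) : ℝ :=
  (Q.step d)^[r] (fun j => if j ≤ n then 1 else 0) i

theorem jumpCdf_eq_sum (d : ℕ → Fin K → ℕ) (r i n : ℕ) :
    Q.jumpCdf d r i n = ∑ j ∈ Finset.range (n + 1), Q.jumpProb d r i j := by
  refine (Q.hasSum_jumpProb_mul d _ r i).unique ?_
  have : HasSum (fun j => if j ∈ Finset.range (n + 1) then Q.jumpProb d r i j else 0) _ :=
    hasSum_sum_of_ne_finset_zero (s := Finset.range (n + 1)) fun j hj => by simp [hj]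
  rw [Finset.sum_congr rfl fun j hj => if_pos hj] at this
  refine this.congr_fun fun j => ?_
  simp

theorem jumpCdf_mem (hd : Q.IsEfficient d) (r i n : ℕ) :
    0 ≤ Q.jumpCdf d r i n ∧ Q.jumpCdf d r i n ≤ 1 := by
  rw [jumpCdf_eq_sum]
  exact ⟨Finset.sum_nonneg fun j _ => Q.jumpProb_nonneg hd r i j,
    sum_le_hasSum _ (fun j _ => Q.jumpProb_nonneg hd r i j) (Q.hasSum_jumpProb d r i)⟩

theorem step_indicator (d : ℕ → Fin K → ℕ) (n : ℕ) :
    Q.step d (fun j => if j ≤ n then 1 else 0) = (fun j => if j ≤ n then 1 else 0)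
      + (Q.rate (d (n + 1)) / Q.unifRate) • Pi.single (n + 1) (1 : ℝ)
      - (Q.lam / Q.unifRate) • Pi.single n (1 : ℝ) := by
  funext j
  simp only [step, gen, Pi.add_apply, Pi.sub_apply, Pi.smul_apply, smul_eq_mul]
  rcases lt_trichotomy j n with h | rfl | h
  · have h1 : j ≤ n := h.le
    have h2 : j + 1 ≤ n := h
    have h3 : j - 1 ≤ n := by omega
    have h4 : j ≠ n + 1 := by omega
    simp [h1, h2, h3, h4, h.ne]
  · simp
    ring
  · rcases Nat.lt_or_ge (n + 1) j with h' | h'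
    · have h1 : ¬ j ≤ n := by omega
      have h2 : ¬ j + 1 ≤ n := by omega
      have h3 : ¬ j - 1 ≤ n := by omega
      have h4 : j ≠ n + 1 := by omega
      simp [h1, h2, h3, h4, h.ne']
    · obtain rfl : j = n + 1 := by omega
      simp

/-- Only the jumps across the cut between `n` and `n + 1` change the mass of `{0, …, n}`. Here the
first factor of the iterate acts on the indicator, which yields the forward rather than the backward
equation. -/
theorem jumpCdf_succ (d : ℕ → Fin K → ℕ) (r i n : ℕ) :
    Q.jumpCdf d (r + 1) i n = Q.jumpCdf d r i n
      + Q.rate (d (n + 1)) / Q.unifRate * Q.jumpProb d r i (n + 1)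
      - Q.lam / Q.unifRate * Q.jumpProb d r i n := by
  simp only [jumpCdf, jumpProb, Function.iterate_succ_apply, step_indicator]
  simp only [iterate_step, map_add, map_sub, map_smul]
  simp

theorem jumpProb_succ_zero (d : ℕ → Fin K → ℕ) (r i : ℕ) :
    Q.jumpProb d (r + 1) i 0 = Q.jumpProb d r i 0
      + Q.rate (d 1) / Q.unifRate * Q.jumpProb d r i 1
      - Q.lam / Q.unifRate * Q.jumpProb d r i 0 := by
  have := Q.jumpCdf_succ d r i 0
  simpa [jumpCdf_eq_sum] using this

theorem jumpProb_succ_succ (d : ℕ → Fin K → ℕ) (r i n : ℕ) :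
    Q.jumpProb d (r + 1) i (n + 1) = Q.jumpProb d r i (n + 1)
      + Q.rate (d (n + 2)) / Q.unifRate * Q.jumpProb d r i (n + 2)
      - Q.lam / Q.unifRate * Q.jumpProb d r i (n + 1)
      - Q.rate (d (n + 1)) / Q.unifRate * Q.jumpProb d r i (n + 1)
      + Q.lam / Q.unifRate * Q.jumpProb d r i n := by
  have h1 := Q.jumpCdf_succ d r i n
  have h2 := Q.jumpCdf_succ d r i (n + 1)
  have h3 : ∀ r, Q.jumpCdf d r i (n + 1) = Q.jumpCdf d r i n + Q.jumpProb d r i (n + 1) := by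
    intro r
    rw [jumpCdf_eq_sum, jumpCdf_eq_sum, Finset.sum_range_succ]
  rw [h3, h3] at h2
  linarith

/-- A nonnegative invariant measure dominates the transition probabilities. -/
theorem mul_jumpProb_le (hd : Q.IsEfficient d) {w : ℕ → ℝ} (hw : ∀ n, 0 ≤ w n)
    (hb : ∀ n, Q.lam * w n = Q.rate (d (n + 1)) * w (n + 1)) (r i j : ℕ) :
    w i * Q.jumpProb d r i j ≤ w j := by
  have hΛ := Q.unifRate_pos
  have hl := div_nonneg Q.lam_pos.le hΛ.le
  have hr := fun n => div_nonneg (Q.rate_nonneg (d n)) hΛ.le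
  have hb' : ∀ n, Q.lam / Q.unifRate * w n = Q.rate (d (n + 1)) / Q.unifRate * w (n + 1) := by
    intro n
    rw [div_mul_eq_mul_div, hb, div_mul_eq_mul_div]
  have hle : ∀ n, Q.lam / Q.unifRate + Q.rate (d n) / Q.unifRate ≤ 1 := by
    intro n
    rw [← add_div]
    exact (div_le_one hΛ).2 (Q.lam_add_rate_le hd n)
  induction r generalizing j with
  | zero =>
    by_cases h : i = j
    · subst h; simp [jumpProb]
    · simpa [jumpProb, h] using hw j
  | succ r ih =>
    cases j with
    | zero =>
      rw [jumpProb_succ_zero]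
      -- Uniformization makes the holding probability nonnegative, so the induction hypothesis may
      -- be inserted in every term; the balance equations then sum the bounds to `w j`.
      have h0 := mul_le_mul_of_nonneg_left (ih 0)
        (show 0 ≤ 1 - Q.lam / Q.unifRate by linarith [hle 0, hr 0])
      have h1 := mul_le_mul_of_nonneg_left (ih 1) (hr 1)
      have := hb' 0
      rw [zero_add] at this
      linarith
    | succ n =>
      rw [jumpProb_succ_succ]
      have h0 := mul_le_mul_of_nonneg_left (ih (n + 1))
        (show 0 ≤ 1 - Q.lam / Q.unifRate - Q.rate (d (n + 1)) / Q.unifRate by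
          linarith [hle (n + 1)])
      have h1 := mul_le_mul_of_nonneg_left (ih (n + 2)) (hr (n + 2))
      have h2 := mul_le_mul_of_nonneg_left (ih n) hl
      have := hb' n
      have := hb' (n + 1)
      rw [show n + 1 + 1 = n + 2 from rfl] at this
      linarith

end GroupServerQueue

/-! ### Poisson mixtures and the continuous-time transition probabilities -/

namespace GroupServerQueue

/-- Differentiating `x ^ r / r!` lowers the index, which shifts `a` by one; boundedness of `a` gives
a summable bound for the derivatives on a ball around `0` containing `x`. -/
theorem hasDerivAt_tsum_pow_div_factorial {a : ℕ → ℝ} (ha : ∀ r, |a r| ≤ 1) (x : ℝ) :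
    HasDerivAt (fun y : ℝ => ∑' r : ℕ, y ^ r / (r.factorial : ℝ) * a r)
      (∑' r : ℕ, x ^ r / (r.factorial : ℝ) * a (r + 1)) x := by
  set R := |x| + 1 with hR
  have hR0 : 0 < R := by positivity
  have hshift : ∀ (y : ℝ) (r : ℕ), ((r + 1 : ℕ) : ℝ) * y ^ (r + 1 - 1) / ((r + 1).factorial : ℝ)
      = y ^ r / (r.factorial : ℝ) := by
    intro y r
    have h1 : (r.factorial : ℝ) ≠ 0 := by positivity
    have h2 : ((r : ℝ) + 1) ≠ 0 := by positivity
    rw [Nat.factorial_succ, Nat.add_sub_cancel]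
    push_cast
    field_simp
  have hu : Summable fun r : ℕ => (r : ℝ) * R ^ (r - 1) / (r.factorial : ℝ) := by
    rw [← summable_nat_add_iff 1]
    exact (Real.summable_pow_div_factorial R).congr fun r => (hshift R r).symm
  have hbound : ∀ (r : ℕ) (y : ℝ), y ∈ Metric.ball (0 : ℝ) R →
      ‖(r : ℝ) * y ^ (r - 1) / (r.factorial : ℝ) * a r‖
        ≤ (r : ℝ) * R ^ (r - 1) / (r.factorial : ℝ) := by
    intro r y hy
    have hy' : |y| ≤ R := by
      have := Metric.mem_ball.1 hy
      rw [dist_zero_right, Real.norm_eq_abs] at this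
      exact this.le
    rw [norm_mul, Real.norm_eq_abs, Real.norm_eq_abs, abs_div, abs_mul, abs_pow, Nat.abs_cast,
      Nat.abs_cast]
    refine (mul_le_of_le_one_right (by positivity) (ha r)).trans ?_
    gcongr
  have hx : x ∈ Metric.ball (0 : ℝ) R := by
    rw [Metric.mem_ball, dist_zero_right, Real.norm_eq_abs]
    linarith
  have key := hasDerivAt_tsum_of_isPreconnected hu Metric.isOpen_ball
    (convex_ball (0 : ℝ) R).isPreconnected
    (g := fun r y => y ^ r / (r.factorial : ℝ) * a r)
    (g' := fun r y => (r : ℝ) * y ^ (r - 1) / (r.factorial : ℝ) * a r)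
    (fun r y _ => ((hasDerivAt_pow r y).div_const _).mul_const _) hbound hx
    ((Real.summable_pow_div_factorial |x|).of_norm_bounded fun r => by
      rw [norm_mul, Real.norm_eq_abs, Real.norm_eq_abs, abs_div, abs_pow, Nat.abs_cast]
      exact mul_le_of_le_one_right (by positivity) (ha r)) hx
  have hs : Summable fun r : ℕ => (r : ℝ) * x ^ (r - 1) / (r.factorial : ℝ) * a r :=
    hu.of_norm_bounded fun r => hbound r x hx
  rw [hs.tsum_eq_zero_add] at key
  simp only [hshift, Nat.cast_zero, zero_mul, zero_div, zero_add] at key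
  exact key

/-- The mean of the sequence `a` under the Poisson distribution of parameter `L * t`. -/
noncomputable def poissonMean (L : ℝ) (a : ℕ → ℝ) (t : ℝ) : ℝ :=
  ∑' r : ℕ, Real.exp (-(L * t)) * (L * t) ^ r / (r.factorial : ℝ) * a r

theorem poissonMean_eq (L : ℝ) (a : ℕ → ℝ) (t : ℝ) :
    poissonMean L a t = Real.exp (-(L * t)) * ∑' r : ℕ, (L * t) ^ r / (r.factorial : ℝ) * a r := by
  rw [poissonMean, ← tsum_mul_left]
  exact tsum_congr fun r => by ring

theorem hasDerivAt_poissonMean (L : ℝ) {a : ℕ → ℝ} (ha : ∀ r, |a r| ≤ 1) (t : ℝ) :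
    HasDerivAt (poissonMean L a)
      (L * (poissonMean L (fun r => a (r + 1)) t - poissonMean L a t)) t := by
  have h0 : HasDerivAt (fun t : ℝ => L * t) L t := by simpa using (hasDerivAt_id t).const_mul L
  have h1 := (hasDerivAt_tsum_pow_div_factorial ha (L * t)).comp t h0
  have h2 := h0.neg.exp.mul h1
  have h3 : poissonMean L a = _ := funext (poissonMean_eq L a)
  rw [poissonMean_eq, poissonMean_eq, h3]
  refine h2.congr_deriv ?_
  simp only [Function.comp_apply, Pi.neg_apply]
  ring

theorem hasSum_poisson (L t : ℝ) :
    HasSum (fun r : ℕ => Real.exp (-(L * t)) * (L * t) ^ r / (r.factorial : ℝ)) 1 := by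
  have h := (NormedSpace.expSeries_div_hasSum_exp (L * t)).mul_left (Real.exp (-(L * t)))
  rw [← Real.exp_eq_exp_ℝ, ← Real.exp_add, neg_add_cancel, Real.exp_zero] at h
  exact h.congr_fun fun r => mul_div_assoc _ _ _

theorem poisson_nonneg {L t : ℝ} (h : 0 ≤ L * t) (r : ℕ) :
    0 ≤ Real.exp (-(L * t)) * (L * t) ^ r / (r.factorial : ℝ) := by
  positivity

theorem summable_poisson_mul {L t : ℝ} (h : 0 ≤ L * t) {a : ℕ → ℝ} (ha : ∀ r, |a r| ≤ 1) :
    Summable fun r : ℕ => Real.exp (-(L * t)) * (L * t) ^ r / (r.factorial : ℝ) * a r :=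
  (hasSum_poisson L t).summable.of_norm_bounded fun r => by
    rw [norm_mul, Real.norm_of_nonneg (poisson_nonneg h r)]
    exact mul_le_of_le_one_right (poisson_nonneg h r) (ha r)

theorem poissonMean_nonneg {L t : ℝ} (h : 0 ≤ L * t) {a : ℕ → ℝ} (ha : ∀ r, 0 ≤ a r) :
    0 ≤ poissonMean L a t :=
  tsum_nonneg fun r => mul_nonneg (poisson_nonneg h r) (ha r)

theorem poissonMean_le {L t : ℝ} (h : 0 ≤ L * t) {a : ℕ → ℝ} (ha : ∀ r, |a r| ≤ 1) {b : ℝ}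
    (hb : ∀ r, a r ≤ b) : poissonMean L a t ≤ b := by
  have := hasSum_le (fun r => mul_le_mul_of_nonneg_left (hb r) (poisson_nonneg h r))
    (summable_poisson_mul h ha).hasSum ((hasSum_poisson L t).mul_right b)
  simpa [poissonMean] using this

variable {K : ℕ} (Q : GroupServerQueue K) {d : ℕ → Fin K → ℕ}

theorem transProb_eq_poissonMean (d : ℕ → Fin K → ℕ) (t : ℝ) (i j : ℕ) :
    Q.transProb d t i j = poissonMean Q.unifRate (fun r => Q.jumpProb d r i j) t := rfl

theorem abs_jumpProb_le_one (hd : Q.IsEfficient d) (r i j : ℕ) : |Q.jumpProb d r i j| ≤ 1 := by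
  rw [abs_of_nonneg (Q.jumpProb_nonneg hd r i j)]
  exact Q.jumpProb_le_one hd r i j

theorem continuous_transProb (hd : Q.IsEfficient d) (i j : ℕ) :
    Continuous fun t => Q.transProb d t i j :=
  continuous_iff_continuousAt.2 fun t =>
    (hasDerivAt_poissonMean Q.unifRate
      (fun r => Q.abs_jumpProb_le_one hd r i j) t).continuousAt

theorem transProb_nonneg (hd : Q.IsEfficient d) {t : ℝ} (ht : 0 ≤ t) (i j : ℕ) :
    0 ≤ Q.transProb d t i j :=
  poissonMean_nonneg (mul_nonneg Q.unifRate_pos.le ht) fun r => Q.jumpProb_nonneg hd r i j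

/-- No mass escapes: the double series over jump counts and states is nonnegative, so it may be
summed in either order. -/
theorem hasSum_transProb (hd : Q.IsEfficient d) {t : ℝ} (ht : 0 ≤ t) (i : ℕ) :
    HasSum (fun j => Q.transProb d t i j) 1 := by
  have hL := mul_nonneg Q.unifRate_pos.le ht
  set F : ℕ × ℕ → ℝ := fun x => Real.exp (-(Q.unifRate * t)) * (Q.unifRate * t) ^ x.1
    / (x.1.factorial : ℝ) * Q.jumpProb d x.1 i x.2 with hF
  have hrow : ∀ r, HasSum (fun j => F (r, j)) _ := fun r =>
    (Q.hasSum_jumpProb d r i).mul_left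
      (Real.exp (-(Q.unifRate * t)) * (Q.unifRate * t) ^ r / (r.factorial : ℝ))
  have hs : Summable F := by
    refine (summable_prod_of_nonneg fun x =>
      mul_nonneg (poisson_nonneg hL x.1) (Q.jumpProb_nonneg hd _ _ _)).2
      ⟨fun r => (hrow r).summable, ?_⟩
    refine (hasSum_poisson Q.unifRate t).summable.congr fun r => ?_
    rw [(hrow r).tsum_eq, mul_one]
  have h1 : HasSum F 1 := by
    have := hs.hasSum.prod_fiberwise hrow
    simp only [mul_one] at this
    rw [← this.unique (hasSum_poisson Q.unifRate t)]
    exact hs.hasSum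
  have h2 : HasSum (fun x : ℕ × ℕ => F x.swap) 1 := (Equiv.prodComm ℕ ℕ).hasSum_iff.2 h1
  exact h2.prod_fiberwise fun j =>
    (summable_poisson_mul hL fun r => Q.abs_jumpProb_le_one hd r i j).hasSum

theorem mul_transProb_le (hd : Q.IsEfficient d) {w : ℕ → ℝ} (hw : ∀ n, 0 ≤ w n)
    (hb : ∀ n, Q.lam * w n = Q.rate (d (n + 1)) * w (n + 1)) {t : ℝ} (ht : 0 ≤ t) {i : ℕ}
    (hi : 0 < w i) (j : ℕ) : Q.transProb d t i j ≤ w j / w i := by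
  refine poissonMean_le (mul_nonneg Q.unifRate_pos.le ht)
    (fun r => Q.abs_jumpProb_le_one hd r i j) fun r => ?_
  rw [le_div_iff₀ hi, mul_comm]
  exact Q.mul_jumpProb_le hd hw hb r i j

/-! ### Time averages and probability flows -/

/-- The occupation measure: the mean fraction of the time in `[0, T]` spent in state `j`. -/
noncomputable def occ (d : ℕ → Fin K → ℕ) (T : ℝ) (i j : ℕ) : ℝ :=
  1 / T * ∫ t in (0 : ℝ)..T, Q.transProb d t i j

theorem occ_nonneg (hd : Q.IsEfficient d) {T : ℝ} (hT : 0 < T) (i j : ℕ) :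
    0 ≤ Q.occ d T i j :=
  mul_nonneg (by positivity)
    (intervalIntegral.integral_nonneg hT.le fun _ ht => Q.transProb_nonneg hd ht.1 i j)

theorem one_div_mul_integral_le {φ ψ : ℝ → ℝ} {T : ℝ} (hT : 0 < T)
    (hφ : IntervalIntegrable φ MeasureTheory.volume 0 T)
    (hψ : IntervalIntegrable ψ MeasureTheory.volume 0 T) (h : ∀ t, 0 ≤ t → φ t ≤ ψ t) :
    1 / T * ∫ t in (0 : ℝ)..T, φ t ≤ 1 / T * ∫ t in (0 : ℝ)..T, ψ t :=
  mul_le_mul_of_nonneg_left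
    (intervalIntegral.integral_mono_on hT.le hφ hψ fun t ht => h t ht.1) (by positivity)

theorem one_div_mul_integral_const {T : ℝ} (hT : 0 < T) (b : ℝ) :
    1 / T * ∫ _ in (0 : ℝ)..T, b = b := by
  rw [intervalIntegral.integral_const, smul_eq_mul, sub_zero, ← mul_assoc,
    one_div_mul_cancel hT.ne', one_mul]

theorem occ_le (hd : Q.IsEfficient d) {w : ℕ → ℝ} (hw : ∀ n, 0 ≤ w n)
    (hb : ∀ n, Q.lam * w n = Q.rate (d (n + 1)) * w (n + 1)) {T : ℝ} (hT : 0 < T) {i : ℕ}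
    (hi : 0 < w i) (j : ℕ) : Q.occ d T i j ≤ w j / w i := by
  rw [← one_div_mul_integral_const hT (w j / w i)]
  exact one_div_mul_integral_le hT ((Q.continuous_transProb hd i j).intervalIntegrable _ _)
    (continuous_const.intervalIntegrable _ _) fun t ht => Q.mul_transProb_le hd hw hb ht hi j

theorem transProb_le_one (hd : Q.IsEfficient d) {t : ℝ} (ht : 0 ≤ t) (i j : ℕ) :
    Q.transProb d t i j ≤ 1 :=
  le_hasSum (Q.hasSum_transProb hd ht i) j fun _ _ => Q.transProb_nonneg hd ht i _

theorem occ_le_one (hd : Q.IsEfficient d) {T : ℝ} (hT : 0 < T) (i j : ℕ) :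
    Q.occ d T i j ≤ 1 := by
  rw [← one_div_mul_integral_const hT 1]
  exact one_div_mul_integral_le hT ((Q.continuous_transProb hd i j).intervalIntegrable _ _)
    (continuous_const.intervalIntegrable _ _) fun t ht => Q.transProb_le_one hd ht i j

/-- The probability flow between `{0, …, n}` and its complement balances up to `1 / T`. -/
theorem abs_occ_flow_le (hd : Q.IsEfficient d) {T : ℝ} (hT : 0 < T) (i n : ℕ) :
    |Q.rate (d (n + 1)) * Q.occ d T i (n + 1) - Q.lam * Q.occ d T i n| ≤ 1 / T := by
  have hL := Q.unifRate_pos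
  have hc := fun r => Q.jumpCdf_mem hd r i n
  have hc' : ∀ r, |Q.jumpCdf d r i n| ≤ 1 := fun r => by
    rw [abs_of_nonneg (hc r).1]
    exact (hc r).2
  -- `F t` is the probability of `{0, …, n}` at time `t`; its derivative is the net flow across the
  -- cut, so the integrated flow is a difference of two numbers in `[0, 1]`.
  set F : ℝ → ℝ := poissonMean Q.unifRate (fun r => Q.jumpCdf d r i n) with hF
  have hderiv : ∀ t, 0 ≤ t → HasDerivAt F (Q.rate (d (n + 1)) * Q.transProb d t i (n + 1)
      - Q.lam * Q.transProb d t i n) t := by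
    intro t ht
    have hLt := mul_nonneg hL.le ht
    refine (hasDerivAt_poissonMean Q.unifRate hc' t).congr_deriv ?_
    have h1 := (summable_poisson_mul hLt hc').hasSum
    have h2 := (summable_poisson_mul hLt
      fun r => Q.abs_jumpProb_le_one hd r i (n + 1)).hasSum.mul_left
        (Q.rate (d (n + 1)) / Q.unifRate)
    have h3 := (summable_poisson_mul hLt
      fun r => Q.abs_jumpProb_le_one hd r i n).hasSum.mul_left (Q.lam / Q.unifRate)
    have h4 : poissonMean Q.unifRate (fun r => Q.jumpCdf d (r + 1) i n) t = _ :=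
      (((h1.add h2).sub h3).congr_fun fun r => by
        simp only [jumpCdf_succ]
        ring).tsum_eq
    rw [h4]
    simp only [transProb_eq_poissonMean, poissonMean]
    field_simp
    ring
  have hi : ∀ (b : ℝ) (j : ℕ),
      IntervalIntegrable (fun t => b * Q.transProb d t i j) MeasureTheory.volume 0 T :=
    fun b j => ((Q.continuous_transProb hd i j).const_mul b).intervalIntegrable _ _
  have hint := intervalIntegral.integral_eq_sub_of_hasDerivAt (a := 0) (b := T) (f := F)
    (fun t ht => hderiv t (by rw [Set.uIcc_of_le hT.le] at ht; exact ht.1))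
    ((hi _ _).sub (hi _ _))
  rw [intervalIntegral.integral_sub (hi _ _) (hi _ _),
    intervalIntegral.integral_const_mul, intervalIntegral.integral_const_mul] at hint
  have hmem : ∀ t, 0 ≤ t → 0 ≤ F t ∧ F t ≤ 1 := fun t ht =>
    ⟨poissonMean_nonneg (mul_nonneg hL.le ht) fun r => (hc r).1,
      poissonMean_le (mul_nonneg hL.le ht) hc' fun r => (hc r).2⟩
  have heq : Q.rate (d (n + 1)) * Q.occ d T i (n + 1) - Q.lam * Q.occ d T i n
      = 1 / T * (F T - F 0) := by
    rw [← hint, occ, occ]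
    ring
  rw [heq, abs_mul, abs_of_pos (by positivity : 0 < 1 / T)]
  refine mul_le_of_le_one_right (by positivity) (abs_le.2 ⟨?_, ?_⟩)
  · linarith [(hmem T hT.le).1, (hmem 0 le_rfl).2]
  · linarith [(hmem T hT.le).2, (hmem 0 le_rfl).1]

theorem tendsto_occ_flow (hd : Q.IsEfficient d) (i n : ℕ) :
    Tendsto (fun T => Q.rate (d (n + 1)) * Q.occ d T i (n + 1) - Q.lam * Q.occ d T i n)
      atTop (𝓝 0) := by
  refine squeeze_zero_norm' (a := fun T : ℝ => 1 / T) ?_ ?_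
  · filter_upwards [eventually_gt_atTop 0] with T hT
    exact Q.abs_occ_flow_le hd hT i n
  · simpa using tendsto_inv_atTop_zero (𝕜 := ℝ)

theorem tendsto_occ_pred (hd : Q.IsEfficient d) {i n : ℕ}
    (h : Tendsto (fun T => Q.rate (d (n + 1)) * Q.occ d T i (n + 1)) atTop (𝓝 0)) :
    Tendsto (fun T => Q.occ d T i n) atTop (𝓝 0) := by
  have h1 := ((h.sub (Q.tendsto_occ_flow hd i n)).const_mul (1 / Q.lam))
  simp only [sub_zero, mul_zero] at h1
  refine h1.congr fun T => ?_
  have := Q.lam_pos.ne'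
  field_simp
  ring

/-- States below a state in which no server works are not visited in the long run. -/
theorem tendsto_occ_of_rate_eq_zero (hd : Q.IsEfficient d) (i : ℕ) {n : ℕ}
    (hn : Q.rate (d n) = 0) {j : ℕ} (hj : j < n) :
    Tendsto (fun T => Q.occ d T i j) atTop (𝓝 0) := by
  obtain ⟨m, rfl⟩ := Nat.exists_eq_add_of_lt hj
  clear hj
  induction m generalizing j with
  | zero =>
    refine Q.tendsto_occ_pred hd ?_
    simp only [add_zero] at hn
    simp [hn]
  | succ m ih =>
    refine Q.tendsto_occ_pred hd ?_
    have := (ih (j := j + 1) (by rwa [show j + 1 + m + 1 = j + (m + 1) + 1 by ring])).const_mul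
      (Q.rate (d (j + 1)))
    simpa using this

/-! ### The invariant measure -/

/-- The invariant measure of the birth-death chain on `{N, N + 1, …}`, of mass `1` at `N`. -/
noncomputable def weight (d : ℕ → Fin K → ℕ) (N : ℕ) : ℕ → ℝ
  | 0 => if N = 0 then 1 else 0
  | n + 1 => if n + 1 = N then 1 else Q.lam / Q.rate (d (n + 1)) * weight d N n

theorem weight_self (d : ℕ → Fin K → ℕ) (N : ℕ) : Q.weight d N N = 1 := by
  cases N <;> simp [weight]

theorem weight_of_lt (d : ℕ → Fin K → ℕ) {N n : ℕ} (h : n < N) : Q.weight d N n = 0 := by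
  induction n with
  | zero => simp [weight, h.ne']
  | succ n ih => simp [weight, h.ne, ih (by omega)]

theorem weight_succ (d : ℕ → Fin K → ℕ) {N n : ℕ} (h : N ≤ n) :
    Q.weight d N (n + 1) = Q.lam / Q.rate (d (n + 1)) * Q.weight d N n := by
  rw [weight, if_neg (by omega)]

theorem weight_nonneg (d : ℕ → Fin K → ℕ) (N n : ℕ) : 0 ≤ Q.weight d N n := by
  induction n with
  | zero => rw [weight]; split_ifs <;> norm_num
  | succ n ih =>
    rw [weight]
    split_ifs
    · norm_num
    · exact mul_nonneg (div_nonneg Q.lam_pos.le (Q.rate_nonneg _)) ih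

theorem weight_pos {N : ℕ} (hpos : ∀ n, N < n → 0 < Q.rate (d n)) {n : ℕ} (h : N ≤ n) :
    0 < Q.weight d N n := by
  induction n, h using Nat.le_induction with
  | base => simp [weight_self]
  | succ n hn ih =>
    rw [weight_succ Q d hn]
    exact mul_pos (div_pos Q.lam_pos (hpos _ (by omega))) ih

theorem weight_balance {N : ℕ} (hN : Q.rate (d N) = 0) (hpos : ∀ n, N < n → 0 < Q.rate (d n))
    (n : ℕ) : Q.lam * Q.weight d N n = Q.rate (d (n + 1)) * Q.weight d N (n + 1) := by
  rcases lt_trichotomy (n + 1) N with h | h | h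
  · rw [weight_of_lt Q d h, weight_of_lt Q d (by omega)]; ring
  · rw [h, hN, weight_of_lt Q d (by omega)]; ring
  · rw [weight_succ Q d (by omega)]
    have := (hpos _ h).ne'
    field_simp

/-- Asymptotic flow balance, iterated upwards from `N`, makes the time averages proportional to the
invariant measure before any of them is known to converge. -/
theorem tendsto_occ_sub_weight (hd : Q.IsEfficient d) (i : ℕ) {N : ℕ} (hN : Q.rate (d N) = 0)
    (hpos : ∀ n, N < n → 0 < Q.rate (d n)) (j : ℕ) :
    Tendsto (fun T => Q.occ d T i j - Q.weight d N j * Q.occ d T i N) atTop (𝓝 0) := by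
  rcases Nat.lt_or_ge j N with h | h
  · simpa [weight_of_lt Q d h] using Q.tendsto_occ_of_rate_eq_zero hd i hN h
  · induction j, h using Nat.le_induction with
    | base => simp [weight_self]
    | succ n hn ih =>
      have h1 := ((Q.tendsto_occ_flow hd i n).const_mul (1 / Q.rate (d (n + 1)))).add
        (ih.const_mul (Q.lam / Q.rate (d (n + 1))))
      simp only [mul_zero, add_zero] at h1
      refine h1.congr fun T => ?_
      rw [weight_succ Q d hn]
      have := (hpos (n + 1) (by omega)).ne'
      field_simp
      ring

/-! ### Finite average cost implies positive recurrence -/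

/-- A bound for the operating cost rate. -/
noncomputable def costBound : ℝ := ∑ k, (Q.M k : ℝ) * |Q.c k|

theorem abs_cost_sub_le (hd : Q.IsEfficient d) (n : ℕ) :
    |Q.cost n (d n) - Q.h n| ≤ Q.costBound := by
  rw [cost, add_sub_cancel_left]
  refine (Finset.abs_sum_le_sum_abs _ _).trans (Finset.sum_le_sum fun k _ => ?_)
  rw [abs_mul, Nat.abs_cast]
  exact mul_le_mul_of_nonneg_right (Nat.cast_le.2 ((hd n).1 k)) (abs_nonneg _)

theorem le_cost (hd : Q.IsEfficient d) (n : ℕ) : Q.h n - Q.costBound ≤ Q.cost n (d n) := by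
  linarith [(abs_le.1 (Q.abs_cost_sub_le hd n)).1]

theorem tendsto_cost (hd : Q.IsEfficient d) : Tendsto (fun n => Q.cost n (d n)) atTop atTop :=
  tendsto_atTop_mono (Q.le_cost hd) (tendsto_atTop_add_const_right _ (-Q.costBound) Q.h_tendsto)

/-- Truncation: a lower bound of the cost rate that is constant from `J` on involves only finitely
many time averages, so limits in `T` can be taken termwise. -/
theorem add_sum_occ_mul_le (hd : Q.IsEfficient d) {η : ℝ} (h : Q.HasAverageCost d η) {T : ℝ}
    (hT : 0 < T) (i J : ℕ) {b : ℝ} {v : ℕ → ℝ}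
    (hv : ∀ j, b + (if j < J then v j else 0) ≤ Q.cost j (d j)) :
    b + ∑ j ∈ Finset.range J, Q.occ d T i j * v j
      ≤ 1 / T * ∫ t in (0 : ℝ)..T, Q.expectedCost d t i := by
  have hi : ∀ j, IntervalIntegrable (fun t => Q.transProb d t i j * v j)
      MeasureTheory.volume 0 T := fun j =>
    ((Q.continuous_transProb hd i j).mul_const _).intervalIntegrable _ _
  have hs : IntervalIntegrable (fun t => ∑ j ∈ Finset.range J, Q.transProb d t i j * v j)
      MeasureTheory.volume 0 T :=
    (continuous_finsetSum _ fun j _ =>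
      (Q.continuous_transProb hd i j).mul_const _).intervalIntegrable _ _
  have heq : b + ∑ j ∈ Finset.range J, Q.occ d T i j * v j
      = 1 / T * ∫ t in (0 : ℝ)..T, (b + ∑ j ∈ Finset.range J, Q.transProb d t i j * v j) := by
    rw [intervalIntegral.integral_add (continuous_const.intervalIntegrable _ _) hs, mul_add,
      one_div_mul_integral_const hT, intervalIntegral.integral_finsetSum fun j _ => hi j,
      Finset.mul_sum]
    congr 1
    refine Finset.sum_congr rfl fun j _ => ?_
    rw [intervalIntegral.integral_mul_const, occ, mul_assoc]
  rw [heq]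
  refine one_div_mul_integral_le hT ((continuous_const.intervalIntegrable _ _).add hs)
    ((h i).2.1 T hT.le) fun t ht => ?_
  have h1 := (Q.hasSum_transProb hd ht i).mul_right b
  have h2 : HasSum (fun j => if j < J then Q.transProb d t i j * v j else 0)
      (∑ j ∈ Finset.range J, if j < J then Q.transProb d t i j * v j else 0) :=
    hasSum_sum_of_ne_finset_zero fun j hj => if_neg (by simpa using hj)
  rw [Finset.sum_congr rfl fun j hj => if_pos (Finset.mem_range.1 hj)] at h2
  have h3 := h1.add h2
  rw [one_mul] at h3
  refine hasSum_le (fun j => ?_) h3 ((h i).1 t ht).hasSum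
  have := mul_le_mul_of_nonneg_left (hv j) (Q.transProb_nonneg hd ht i j)
  refine le_trans (le_of_eq ?_) this
  split_ifs <;> ring

/-- Tightness: time spent in high states is too expensive for a finite average cost. -/
theorem exists_half_le_sum_occ (hd : Q.IsEfficient d) {η : ℝ} (h : Q.HasAverageCost d η)
    (i : ℕ) : ∃ J, ∀ᶠ T in atTop, 1 / 2 ≤ ∑ j ∈ Finset.range J, Q.occ d T i j := by
  obtain ⟨F, hF⟩ : ∃ F, ∀ j, -F ≤ Q.cost j (d j) :=
    ⟨-(Q.h 0 - Q.costBound), fun j => by linarith [Q.le_cost hd j, Q.h_mono (Nat.zero_le j)]⟩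
  -- The cost is at least `-F` everywhere and `L - F` from `J` on. With less than half of the time
  -- below `J` the average would exceed `L / 2 - F ≥ η + 1`.
  set L := 2 * (|η| + |F| + 1) with hL
  have hL0 : 0 < L := by positivity
  obtain ⟨J, hJ⟩ := eventually_atTop.1 ((Q.tendsto_cost hd).eventually_ge_atTop (L - F))
  refine ⟨J, ?_⟩
  filter_upwards [eventually_gt_atTop 0, (h i).2.2.eventually_le_const (lt_add_one η)]
    with T hT hT'
  have h1 := Q.add_sum_occ_mul_le hd h hT i J (b := L - F) (v := fun _ => -L) fun j => by
    split_ifs with hj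
    · linarith [hF j]
    · linarith [hJ j (not_lt.1 hj)]
  rw [← Finset.sum_mul] at h1
  have h2 := le_abs_self η
  have h3 := le_abs_self F
  by_contra! hlt
  have := mul_lt_mul_of_pos_right hlt hL0
  linarith

/-- A policy of finite average cost makes its chain positive recurrent, and its cost rate is
integrable with respect to the invariant measure. -/
theorem exists_summable_weight (hd : Q.IsEfficient d) {η : ℝ} (h : Q.HasAverageCost d η) :
    ∃ N, Q.rate (d N) = 0 ∧ (∀ n, N < n → 0 < Q.rate (d n)) ∧ Summable (Q.weight d N) ∧
      Summable fun n => Q.weight d N n * Q.cost n (d n) := by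
  obtain ⟨J, hJ⟩ := Q.exists_half_le_sum_occ hd h 0
  have hbdd : ∀ n, Q.rate (d n) = 0 → n ≤ J := by
    intro n hn
    by_contra! hlt
    have h1 : Tendsto (fun T => ∑ j ∈ Finset.range J, Q.occ d T 0 j) atTop
        (𝓝 (∑ j ∈ Finset.range J, (0 : ℝ))) := tendsto_finsetSum _ fun j hj =>
      Q.tendsto_occ_of_rate_eq_zero hd 0 hn ((Finset.mem_range.1 hj).trans hlt)
    have := ge_of_tendsto h1 hJ
    norm_num at this
  obtain ⟨N, hN, hmax⟩ : ∃ N, Q.rate (d N) = 0 ∧ ∀ n, Q.rate (d n) = 0 → n ≤ N := by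
    classical
    exact ⟨Nat.findGreatest (fun n => Q.rate (d n) = 0) J,
      Nat.findGreatest_spec (P := fun n => Q.rate (d n) = 0) (Nat.zero_le J) hd.rate_zero,
      fun n hn => Nat.le_findGreatest (hbdd n hn) hn⟩
  have hpos : ∀ n, N < n → 0 < Q.rate (d n) := fun n hn =>
    (Q.rate_nonneg _).lt_of_ne fun h0 => by have := hmax n h0.symm; omega
  have hsub : ∀ (m : ℕ) (v : ℕ → ℝ), Tendsto (fun T => ∑ j ∈ Finset.range m,
      Q.occ d T 0 j * v j - (∑ j ∈ Finset.range m, Q.weight d N j * v j) * Q.occ d T 0 N)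
      atTop (𝓝 0) := by
    intro m v
    have := tendsto_finsetSum (Finset.range m) fun j _ =>
      (Q.tendsto_occ_sub_weight hd 0 hN hpos j).mul_const (v j)
    simp only [zero_mul, Finset.sum_const_zero] at this
    refine this.congr fun T => ?_
    rw [Finset.sum_mul, ← Finset.sum_sub_distrib]
    exact Finset.sum_congr rfl fun j _ => by ring
  obtain ⟨a, ha, haT⟩ : ∃ a, 0 < a ∧ ∀ᶠ T in atTop, a ≤ Q.occ d T 0 N := by
    have h1 := hsub J fun _ => 1
    simp only [mul_one] at h1
    set S := ∑ j ∈ Finset.range J, Q.weight d N j with hS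
    have hS0 : 0 ≤ S := Finset.sum_nonneg fun j _ => Q.weight_nonneg d N j
    -- For large `T` the time below `J` is at least `1 / 2` and within `1 / 4` above `S * occ N`,
    -- hence `S * occ N ≥ 1 / 4`.
    refine ⟨1 / (4 * (S + 1)), by positivity, ?_⟩
    filter_upwards [hJ, h1.eventually_le_const (show (0 : ℝ) < 1 / 4 by norm_num),
      eventually_gt_atTop 0] with T h2 h3 hT
    rw [div_le_iff₀ (by positivity)]
    have := Q.occ_nonneg hd hT 0 N
    nlinarith
  -- Shifting the cost above `1`, not just above `0`, lets one bound yield summability of the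
  -- weights too.
  obtain ⟨F, hF⟩ : ∃ F, ∀ j, 1 ≤ Q.cost j (d j) + F :=
    ⟨1 - (Q.h 0 - Q.costBound), fun j => by
      linarith [Q.le_cost hd j, Q.h_mono (Nat.zero_le j)]⟩
  have hle : ∀ m, ∑ j ∈ Finset.range m, Q.weight d N j * (Q.cost j (d j) + F)
      ≤ (|η + F| + 2) / a := by
    intro m
    have hnn : 0 ≤ ∑ j ∈ Finset.range m, Q.weight d N j * (Q.cost j (d j) + F) :=
      Finset.sum_nonneg fun j _ => mul_nonneg (Q.weight_nonneg d N j) (by linarith [hF j])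
    -- One large `T` suffices: writing `Σ` for the partial sum, `a * Σ ≤ occ N * Σ ≤ ∑ occ j * (cost
    -- j + F) + 1 ≤ η + F + 2`.
    obtain ⟨T, hT, h1, h2, h3⟩ := ((eventually_gt_atTop 0).and (haT.and
      (((hsub m fun j => Q.cost j (d j) + F).eventually_const_le
        (show (-1 : ℝ) < 0 by norm_num)).and
      ((h 0).2.2.eventually_le_const (lt_add_one η))))).exists
    have h4 := Q.add_sum_occ_mul_le hd h hT 0 m (b := -F) (v := fun j => Q.cost j (d j) + F)
      fun j => by
        split_ifs with hj
        · linarith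
        · linarith [hF j]
    rw [le_div_iff₀ ha]
    have := mul_le_mul_of_nonneg_left h1 hnn
    linarith [le_abs_self (η + F)]
  have hsum : Summable fun n => Q.weight d N n * (Q.cost n (d n) + F) :=
    summable_of_sum_range_le
      (fun n => mul_nonneg (Q.weight_nonneg d N n) (by linarith [hF n])) hle
  have hw : Summable (Q.weight d N) := Summable.of_nonneg_of_le (Q.weight_nonneg d N)
    (fun n => le_mul_of_one_le_right (Q.weight_nonneg d N n) (hF n)) hsum
  exact ⟨N, hN, hpos, hw, (hsum.sub (hw.mul_right F)).congr fun n => by ring⟩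

/-! ### The ergodic theorem -/

theorem abs_transProb_mul_le (hd : Q.IsEfficient d) {N : ℕ} (hN : Q.rate (d N) = 0)
    (hpos : ∀ n, N < n → 0 < Q.rate (d n)) {i : ℕ} (hi : N ≤ i) (v : ℕ → ℝ) {t : ℝ} (ht : 0 ≤ t)
    (j : ℕ) : ‖Q.transProb d t i j * v j‖ ≤ |Q.weight d N j * v j| / Q.weight d N i := by
  have hwi := Q.weight_pos hpos hi
  rw [norm_mul, Real.norm_of_nonneg (Q.transProb_nonneg hd ht i j), Real.norm_eq_abs, abs_mul,
    abs_of_nonneg (Q.weight_nonneg d N j), mul_div_right_comm]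
  exact mul_le_mul_of_nonneg_right (Q.mul_transProb_le hd (Q.weight_nonneg d N)
    (Q.weight_balance hN hpos) ht hwi j) (abs_nonneg _)

theorem summable_transProb_mul (hd : Q.IsEfficient d) {N : ℕ} (hN : Q.rate (d N) = 0)
    (hpos : ∀ n, N < n → 0 < Q.rate (d n)) {i : ℕ} (hi : N ≤ i) {v : ℕ → ℝ}
    (hv : Summable fun j => Q.weight d N j * v j) {t : ℝ} (ht : 0 ≤ t) :
    Summable fun j => Q.transProb d t i j * v j :=
  (hv.abs.div_const _).of_norm_bounded (Q.abs_transProb_mul_le hd hN hpos hi v ht)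

theorem intervalIntegrable_tsum_transProb (hd : Q.IsEfficient d) {N : ℕ}
    (hN : Q.rate (d N) = 0) (hpos : ∀ n, N < n → 0 < Q.rate (d n)) {i : ℕ} (hi : N ≤ i)
    {v : ℕ → ℝ} (hv : Summable fun j => Q.weight d N j * v j) {T : ℝ} (hT : 0 ≤ T) :
    IntervalIntegrable (fun t => ∑' j, Q.transProb d t i j * v j) MeasureTheory.volume 0 T := by
  refine ContinuousOn.intervalIntegrable ?_
  rw [Set.uIcc_of_le hT]
  exact continuousOn_tsum
    (fun j => ((Q.continuous_transProb hd i j).mul_const _).continuousOn)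
    (hv.abs.div_const _) fun j t ht => Q.abs_transProb_mul_le hd hN hpos hi v ht.1 j

theorem hasSum_occ_mul (hd : Q.IsEfficient d) {N : ℕ} (hN : Q.rate (d N) = 0)
    (hpos : ∀ n, N < n → 0 < Q.rate (d n)) {i : ℕ} (hi : N ≤ i) {v : ℕ → ℝ}
    (hv : Summable fun j => Q.weight d N j * v j) {T : ℝ} (hT : 0 ≤ T) :
    HasSum (fun j => Q.occ d T i j * v j)
      (1 / T * ∫ t in (0 : ℝ)..T, ∑' j, Q.transProb d t i j * v j) := by
  have hmem : ∀ t, t ∈ Set.uIoc 0 T → 0 ≤ t := fun t ht => by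
    rw [Set.uIoc_of_le hT] at ht
    exact ht.1.le
  have h1 := intervalIntegral.hasSum_integral_of_dominated_convergence
    (μ := MeasureTheory.volume) (a := 0) (b := T)
    (F := fun j t => Q.transProb d t i j * v j) (f := fun t => ∑' j, Q.transProb d t i j * v j)
    (fun j _ => |Q.weight d N j * v j| / Q.weight d N i)
    (fun j => ((Q.continuous_transProb hd i j).mul_const _).aestronglyMeasurable)
    (fun j => .of_forall fun t ht => Q.abs_transProb_mul_le hd hN hpos hi v (hmem t ht) j)
    (.of_forall fun t _ => hv.abs.div_const _)
    (continuous_const.intervalIntegrable _ _)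
    (.of_forall fun t ht => (Q.summable_transProb_mul hd hN hpos hi hv (hmem t ht)).hasSum)
  refine (h1.mul_left (1 / T)).congr_fun fun j => ?_
  rw [intervalIntegral.integral_mul_const, occ, mul_assoc]

theorem tendsto_occ (hd : Q.IsEfficient d) {N : ℕ} (hN : Q.rate (d N) = 0)
    (hpos : ∀ n, N < n → 0 < Q.rate (d n)) (hw : Summable (Q.weight d N)) {i : ℕ} (hi : N ≤ i)
    (j : ℕ) : Tendsto (fun T => Q.occ d T i j) atTop
      (𝓝 (Q.weight d N j / ∑' n, Q.weight d N n)) := by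
  have hwi := Q.weight_pos hpos hi
  have hS : 0 < ∑' n, Q.weight d N n :=
    hw.tsum_pos (Q.weight_nonneg d N) N (Q.weight_pos hpos le_rfl)
  have hone : ∀ T, 0 < T → HasSum (fun j => Q.occ d T i j) 1 := by
    intro T hT
    have h1 := Q.hasSum_occ_mul hd hN hpos hi (v := fun _ => 1) (by simpa using hw) hT.le
    rw [intervalIntegral.integral_congr (g := fun _ => (1 : ℝ)) fun t ht => ?_,
      one_div_mul_integral_const hT] at h1
    · simpa using h1
    · rw [Set.uIcc_of_le hT.le] at ht
      simpa using (Q.hasSum_transProb hd ht.1 i).tsum_eq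
  -- For `T > 0` this series equals `1 - occ N * ∑ weight`, so its vanishing identifies the limit of
  -- `occ N`.
  have h1 : Tendsto (fun T => ∑' j, (Q.occ d T i j - Q.weight d N j * Q.occ d T i N)) atTop
      (𝓝 (∑' _ : ℕ, (0 : ℝ))) := by
    refine tendsto_tsum_of_dominated_convergence
      ((hw.div_const (Q.weight d N i)).add hw)
      (fun j => Q.tendsto_occ_sub_weight hd i hN hpos j) ?_
    filter_upwards [eventually_gt_atTop 0] with T hT j
    have ha := Q.occ_nonneg hd hT i j
    have hb := Q.occ_le hd (Q.weight_nonneg d N) (Q.weight_balance hN hpos) hT hwi j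
    have hc := mul_le_of_le_one_right (Q.weight_nonneg d N j) (Q.occ_le_one hd hT i N)
    have he := mul_nonneg (Q.weight_nonneg d N j) (Q.occ_nonneg hd hT i N)
    rw [Real.norm_eq_abs, abs_le]
    constructor <;> linarith
  have h2 : Tendsto (fun T => Q.occ d T i N) atTop (𝓝 (1 / ∑' n, Q.weight d N n)) := by
    have h3 := (h1.const_sub 1).div_const (∑' n, Q.weight d N n)
    simp only [tsum_zero, sub_zero] at h3
    refine h3.congr' ?_
    filter_upwards [eventually_gt_atTop 0] with T hT
    rw [((hone T hT).sub (hw.hasSum.mul_right (Q.occ d T i N))).tsum_eq]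
    field_simp
    ring
  have h3 := (Q.tendsto_occ_sub_weight hd i hN hpos j).add (h2.const_mul (Q.weight d N j))
  rw [zero_add, mul_one_div] at h3
  exact h3.congr fun T => by ring

/-- The ergodic theorem: if the invariant measure is finite and integrates the cost rate, then the
average cost from every recurrent state is the stationary mean of the cost rate. -/
theorem average_cost_from (hd : Q.IsEfficient d) {N : ℕ} (hN : Q.rate (d N) = 0)
    (hpos : ∀ n, N < n → 0 < Q.rate (d n)) (hw : Summable (Q.weight d N))
    (hwf : Summable fun n => Q.weight d N n * Q.cost n (d n)) {i : ℕ} (hi : N ≤ i) :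
    (∀ t : ℝ, 0 ≤ t → Summable fun j : ℕ => Q.transProb d t i j * Q.cost j (d j)) ∧
    (∀ T : ℝ, 0 ≤ T →
      IntervalIntegrable (fun t => Q.expectedCost d t i) MeasureTheory.volume 0 T) ∧
    Tendsto (fun T : ℝ => 1 / T * ∫ t in (0 : ℝ)..T, Q.expectedCost d t i) atTop
      (𝓝 ((∑' n, Q.weight d N n * Q.cost n (d n)) / ∑' n, Q.weight d N n)) := by
  refine ⟨fun t ht => Q.summable_transProb_mul hd hN hpos hi hwf ht,
    fun T hT => Q.intervalIntegrable_tsum_transProb hd hN hpos hi hwf hT, ?_⟩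
  have hwi := Q.weight_pos hpos hi
  have h1 : Tendsto (fun T => ∑' j, Q.occ d T i j * Q.cost j (d j)) atTop
      (𝓝 (∑' j, Q.weight d N j / (∑' n, Q.weight d N n) * Q.cost j (d j))) := by
    refine tendsto_tsum_of_dominated_convergence (hwf.abs.div_const (Q.weight d N i))
      (fun j => (Q.tendsto_occ hd hN hpos hw hi j).mul_const _) ?_
    filter_upwards [eventually_gt_atTop 0] with T hT j
    rw [norm_mul, Real.norm_of_nonneg (Q.occ_nonneg hd hT i j), Real.norm_eq_abs, abs_mul,
      abs_of_nonneg (Q.weight_nonneg d N j), mul_div_right_comm]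
    exact mul_le_mul_of_nonneg_right (Q.occ_le hd (Q.weight_nonneg d N)
      (Q.weight_balance hN hpos) hT hwi j) (abs_nonneg _)
  have h2 : ∑' j, Q.weight d N j / (∑' n, Q.weight d N n) * Q.cost j (d j)
      = (∑' n, Q.weight d N n * Q.cost n (d n)) / ∑' n, Q.weight d N n := by
    rw [← tsum_div_const]
    exact tsum_congr fun j => by ring
  rw [h2] at h1
  refine h1.congr' ?_
  filter_upwards [eventually_ge_atTop 0] with T hT
  exact (Q.hasSum_occ_mul hd hN hpos hi hwf hT).tsum_eq

end GroupServerQueue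

/-! ### The Poisson equation and policy improvement -/

namespace GroupServerQueue

variable {K : ℕ} (Q : GroupServerQueue K) {d d' : ℕ → Fin K → ℕ}

/-- The residual of the Poisson equation for `d`, in terms of the differences `G` of the
potential. -/
noncomputable def residual (d : ℕ → Fin K → ℕ) (η : ℝ) (G : ℕ → ℝ) (n : ℕ) : ℝ :=
  Q.cost n (d n) - η + Q.lam * G (n + 1) - Q.rate (d n) * G n

theorem residual_prf {η : ℝ} {g : ℕ → ℝ} (hg : Q.IsPotential d η g) (n : ℕ) :
    Q.residual d η (prf g) n = 0 := by
  rw [← hg n, residual, gen, prf, prf, Nat.add_sub_cancel]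
  ring

/-- By the balance equations the terms in `G` telescope, leaving one boundary term. -/
theorem sum_weight_mul_residual (hd : Q.IsEfficient d) {N : ℕ} (hN : Q.rate (d N) = 0)
    (hpos : ∀ n, N < n → 0 < Q.rate (d n)) (η : ℝ) (G : ℕ → ℝ) (n : ℕ) :
    ∑ j ∈ Finset.range (n + 1), Q.weight d N j * Q.residual d η G j
      = ∑ j ∈ Finset.range (n + 1), (Q.weight d N j * Q.cost j (d j) - Q.weight d N j * η)
        + Q.lam * (Q.weight d N n * G (n + 1)) := by
  induction n with
  | zero =>
    simp only [zero_add, Finset.range_one, Finset.sum_singleton, residual, hd.rate_zero]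
    ring
  | succ n ih =>
    rw [Finset.sum_range_succ, ih, Finset.sum_range_succ _ (n + 1), residual, ← mul_assoc,
      Q.weight_balance hN hpos n]
    ring

theorem hasSum_weight_mul_sub {N : ℕ} (hpos : ∀ n, N < n → 0 < Q.rate (d n))
    (hw : Summable (Q.weight d N)) (hwf : Summable fun n => Q.weight d N n * Q.cost n (d n))
    (η : ℝ) : HasSum (fun n => Q.weight d N n * Q.cost n (d n) - Q.weight d N n * η)
      ((∑' n, Q.weight d N n) *
        ((∑' n, Q.weight d N n * Q.cost n (d n)) / (∑' n, Q.weight d N n) - η)) := by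
  have hS : 0 < ∑' n, Q.weight d N n :=
    hw.tsum_pos (Q.weight_nonneg d N) N (Q.weight_pos hpos le_rfl)
  rw [mul_sub, mul_div_cancel₀ _ hS.ne']
  exact hwf.hasSum.sub (hw.hasSum.mul_right η)

section Improvement

variable {N : ℕ} {η : ℝ} {G : ℕ → ℝ}

theorem weight_mul_eq_neg_sum (hd : Q.IsEfficient d) (hN : Q.rate (d N) = 0)
    (hpos : ∀ n, N < n → 0 < Q.rate (d n)) (hG : ∀ n, Q.residual d η G n = 0) (n : ℕ) :
    Q.lam * (Q.weight d N n * G (n + 1)) =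
      -∑ j ∈ Finset.range (n + 1), (Q.weight d N j * Q.cost j (d j) - Q.weight d N j * η) := by
  have := Q.sum_weight_mul_residual hd hN hpos η G n
  simp only [hG, mul_zero, Finset.sum_const_zero] at this
  linarith

/-- The sum of `weight * (cost - η)` is zero, so `λ * weight n * G (n + 1)` equals its tail beyond
`n`, whose terms are nonnegative once the cost exceeds `η`. -/
theorem eventually_nonneg_of_residual (hd : Q.IsEfficient d) (hN : Q.rate (d N) = 0)
    (hpos : ∀ n, N < n → 0 < Q.rate (d n)) (hw : Summable (Q.weight d N))
    (hwf : Summable fun n => Q.weight d N n * Q.cost n (d n))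
    (hη : η = (∑' n, Q.weight d N n * Q.cost n (d n)) / ∑' n, Q.weight d N n)
    (hG : ∀ n, Q.residual d η G n = 0) : ∀ᶠ n in atTop, 0 ≤ G n := by
  have hs := Q.hasSum_weight_mul_sub hpos hw hwf η
  rw [← hη, sub_self, mul_zero] at hs
  obtain ⟨m, hm⟩ := eventually_atTop.1 ((Q.tendsto_cost hd).eventually_ge_atTop η)
  filter_upwards [eventually_ge_atTop (m + N + 1)] with n hn
  obtain ⟨n, rfl⟩ : ∃ p, n = p + 1 := ⟨n - 1, by omega⟩
  have h1 := Q.weight_mul_eq_neg_sum hd hN hpos hG n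
  have h2 := sum_le_hasSum (Finset.range (n + 1)) (fun j hj => by
    have hj' : n + 1 ≤ j := by simpa using hj
    rw [← mul_sub]
    exact mul_nonneg (Q.weight_nonneg d N j) (sub_nonneg.2 (hm j (by omega)))) hs
  have h3 : 0 < Q.lam * Q.weight d N n := mul_pos Q.lam_pos (Q.weight_pos hpos (by omega))
  by_contra! hlt
  have := mul_neg_of_pos_of_neg h3 hlt
  linarith

theorem tendsto_weight_mul (hd : Q.IsEfficient d) (hN : Q.rate (d N) = 0)
    (hpos : ∀ n, N < n → 0 < Q.rate (d n)) (hw : Summable (Q.weight d N))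
    (hwf : Summable fun n => Q.weight d N n * Q.cost n (d n))
    (hη : η = (∑' n, Q.weight d N n * Q.cost n (d n)) / ∑' n, Q.weight d N n)
    (hG : ∀ n, Q.residual d η G n = 0) :
    Tendsto (fun n => Q.lam * (Q.weight d N n * G (n + 1))) atTop (𝓝 0) := by
  have hs := Q.hasSum_weight_mul_sub hpos hw hwf η
  rw [← hη, sub_self, mul_zero] at hs
  have h1 := (hs.tendsto_sum_nat.comp (tendsto_add_atTop_nat 1)).neg
  rw [neg_zero] at h1
  exact h1.congr fun n => (Q.weight_mul_eq_neg_sum hd hN hpos hG n).symm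

/-- Beyond `m` both measures obey the same recursion. Summability and decay of the boundary term
thus pass from `d` to `d'`. -/
theorem weight_eq_mul {N' m n : ℕ} (hm : N ≤ m) (hm' : N' ≤ m)
    (hpos : ∀ n, N < n → 0 < Q.rate (d n)) (hdd : ∀ n, m < n → d' n = d n) (hn : m ≤ n) :
    Q.weight d' N' n = Q.weight d' N' m / Q.weight d N m * Q.weight d N n := by
  induction n, hn using Nat.le_induction with
  | base => rw [div_mul_cancel₀ _ (Q.weight_pos hpos hm).ne']
  | succ n hn ih =>
    rw [weight_succ Q d' (hm'.trans hn), weight_succ Q d (hm.trans hn), ih, hdd _ (by omega)]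
    ring

/-- Policy improvement: an irreducible policy that differs from `d` in finitely many states only,
and for which some modification of the potential of `d` in finitely many states makes the
residual of the Poisson equation nonpositive and not zero, has a smaller average cost. -/
theorem exists_lt_hasAverageCost (hd : Q.IsEfficient d) (hN : Q.rate (d N) = 0)
    (hpos : ∀ n, N < n → 0 < Q.rate (d n)) (hw : Summable (Q.weight d N))
    (hwf : Summable fun n => Q.weight d N n * Q.cost n (d n))
    (hη : η = (∑' n, Q.weight d N n * Q.cost n (d n)) / ∑' n, Q.weight d N n)
    (hG : ∀ n, Q.residual d η G n = 0) (hd' : Q.IsEfficient d')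
    (hpos' : ∀ n, 0 < n → 0 < Q.rate (d' n)) {m : ℕ} (hm : N ≤ m)
    (hdd : ∀ n, m < n → d' n = d n) {G' : ℕ → ℝ} (hGG : ∀ n, m < n → G' n = G n)
    (hres : ∀ n, Q.residual d' η G' n ≤ 0) {n₀ : ℕ} (hlt : Q.residual d' η G' n₀ < 0) :
    ∃ η' < η, Q.HasAverageCost d' η' := by
  have hN' := hd'.rate_zero
  set a := Q.weight d' 0 m / Q.weight d N m with ha
  have hweq : ∀ n, Q.weight d' 0 (n + (m + 1)) = a * Q.weight d N (n + (m + 1)) := fun n =>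
    Q.weight_eq_mul hm (Nat.zero_le m) hpos hdd (by omega)
  have hw' : Summable (Q.weight d' 0) := by
    rw [← summable_nat_add_iff (m + 1)]
    exact (((summable_nat_add_iff (m + 1)).2 hw).mul_left a).congr fun n => (hweq n).symm
  have hwf' : Summable fun n => Q.weight d' 0 n * Q.cost n (d' n) := by
    rw [← summable_nat_add_iff (m + 1)]
    refine (((summable_nat_add_iff (m + 1)).2 hwf).mul_left a).congr fun n => ?_
    rw [hweq, hdd _ (by omega)]
    ring
  have hS : 0 < ∑' n, Q.weight d' 0 n :=
    hw'.tsum_pos (Q.weight_nonneg d' 0) 0 (Q.weight_pos hpos' le_rfl)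
  refine ⟨(∑' n, Q.weight d' 0 n * Q.cost n (d' n)) / ∑' n, Q.weight d' 0 n, ?_, fun i =>
    Q.average_cost_from hd' hN' hpos' hw' hwf' (Nat.zero_le i)⟩
  have h1 : Tendsto (fun n => Q.lam * (Q.weight d' 0 n * G' (n + 1))) atTop (𝓝 0) := by
    have h2 := (Q.tendsto_weight_mul hd hN hpos hw hwf hη hG).const_mul a
    rw [mul_zero] at h2
    refine h2.congr' ?_
    filter_upwards [eventually_ge_atTop m] with n hn
    rw [Q.weight_eq_mul hm (Nat.zero_le m) hpos hdd hn, hGG _ (by omega)]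
    ring
  -- The limit is the total mass times `η' - η`; by telescoping, the sequence consists of partial
  -- sums of the weighted residuals.
  have h3 := ((Q.hasSum_weight_mul_sub hpos' hw' hwf' η).tendsto_sum_nat.comp
    (tendsto_add_atTop_nat 1)).add h1
  have h4 : ∀ᶠ n in atTop, ∑ j ∈ Finset.range (n + 1),
      (Q.weight d' 0 j * Q.cost j (d' j) - Q.weight d' 0 j * η)
        + Q.lam * (Q.weight d' 0 n * G' (n + 1))
      ≤ Q.weight d' 0 n₀ * Q.residual d' η G' n₀ := by
    filter_upwards [eventually_ge_atTop n₀] with n hn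
    rw [← Q.sum_weight_mul_residual hd' hN' hpos' η G' n,
      ← Finset.add_sum_erase _ _ (Finset.mem_range.2 (Nat.lt_succ_of_le hn))]
    have := Finset.sum_nonpos fun j (_ : j ∈ (Finset.range (n + 1)).erase n₀) =>
      mul_nonpos_of_nonneg_of_nonpos (Q.weight_nonneg d' 0 j) (hres j)
    linarith
  have h5 := le_of_tendsto h3 h4
  have h6 := mul_neg_of_pos_of_neg (Q.weight_pos hpos' (Nat.zero_le n₀)) hlt
  by_contra! hle
  have := mul_nonneg hS.le (sub_nonneg.2 hle)
  linarith

end Improvement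

/-- What optimality of `d` amounts to. -/
theorem IsOptimal.no_improvement {η : ℝ} {g : ℕ → ℝ} (hd : Q.IsOptimal d)
    (hη : Q.HasAverageCost d η) (hg : Q.IsPotential d η g) :
    ∃ N, Q.rate (d N) = 0 ∧ (∀ n, N < n → 0 < Q.rate (d n)) ∧ (∀ᶠ n in atTop, 0 ≤ prf g n) ∧
      ∀ (d' : ℕ → Fin K → ℕ) (G' : ℕ → ℝ) (m : ℕ), Q.IsEfficient d' →
        (∀ n, 0 < n → 0 < Q.rate (d' n)) → N ≤ m → (∀ n, m < n → d' n = d n) →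
        (∀ n, m < n → G' n = prf g n) → (∀ n, Q.residual d' η G' n ≤ 0) →
        ∀ n, 0 ≤ Q.residual d' η G' n := by
  obtain ⟨heff, η₀, hη₀, hmin⟩ := hd
  obtain rfl : η₀ = η := tendsto_nhds_unique (hη₀ 0).2.2 (hη 0).2.2
  obtain ⟨N, hN, hpos, hw, hwf⟩ := Q.exists_summable_weight heff hη
  have hmean := tendsto_nhds_unique (hη N).2.2
    (Q.average_cost_from heff hN hpos hw hwf le_rfl).2.2
  have hG := Q.residual_prf hg
  refine ⟨N, hN, hpos, Q.eventually_nonneg_of_residual heff hN hpos hw hwf hmean hG, ?_⟩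
  intro d' G' m hd' hpos' hm hdd hGG hres n
  by_contra! hlt
  obtain ⟨η', hη', havg⟩ := Q.exists_lt_hasAverageCost heff hN hpos hw hwf hmean hG hd' hpos' hm
    hdd hGG hres hlt
  exact hη'.not_ge (hmin d' η' hd' havg)

/-! ### Gains and their maximizers -/

/-- The net rate of gain from the action `m` when the departure of a customer is worth `x`. -/
noncomputable def gain (x : ℝ) (m : Fin K → ℕ) : ℝ := ∑ k, (m k : ℝ) * (Q.mu k * x - Q.c k)

/-- The actions that an efficient policy may take with `n` customers present. -/
def IsFeasible (n : ℕ) (m : Fin K → ℕ) : Prop := (∀ k, m k ≤ Q.M k) ∧ total m ≤ n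

theorem gain_add (x : ℝ) (m m' : Fin K → ℕ) :
    Q.gain x (m + m') = Q.gain x m + Q.gain x m' := by
  simp only [gain, Pi.add_apply, Nat.cast_add, add_mul, Finset.sum_add_distrib]

theorem gain_single (x : ℝ) (k : Fin K) :
    Q.gain x (Pi.single k 1) = Q.mu k * x - Q.c k := by
  rw [gain, Finset.sum_eq_single k]
  · simp
  · intro j _ hj
    simp [hj]
  · simp

theorem rate_single (k : Fin K) : Q.rate (Pi.single k 1) = Q.mu k := by
  rw [rate, Finset.sum_eq_single k]
  · simp
  · intro j _ hj
    simp [hj]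
  · simp

theorem total_add (m m' : Fin K → ℕ) : total (m + m') = total m + total m' :=
  Finset.sum_add_distrib

theorem total_single (k : Fin K) : total (Pi.single k 1 : Fin K → ℕ) = 1 := by
  simp [total]

theorem exists_eq_add_single {m : Fin K → ℕ} {k : Fin K} (h : 0 < m k) :
    ∃ p : Fin K → ℕ, m = p + Pi.single k 1 := by
  refine ⟨m - Pi.single k 1, funext fun j => ?_⟩
  simp only [Pi.add_apply, Pi.sub_apply]
  by_cases hj : j = k
  · subst hj
    rw [Pi.single_eq_same]
    omega
  · simp [hj]

theorem eq_zero_of_rate_eq_zero {m : Fin K → ℕ} (h : Q.rate m = 0) : m = 0 := by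
  funext j
  have := (Finset.sum_eq_zero_iff_of_nonneg fun j _ =>
    mul_nonneg (Nat.cast_nonneg _) (Q.mu_pos j).le).1 h j (Finset.mem_univ j)
  rcases mul_eq_zero.1 this with h | h
  · exact_mod_cast h
  · exact absurd h (Q.mu_pos j).ne'

theorem gain_zero (x : ℝ) : Q.gain x 0 = 0 := by simp [gain]

theorem gain_mono {x y : ℝ} (h : y ≤ x) (m : Fin K → ℕ) : Q.gain y m ≤ Q.gain x m :=
  Finset.sum_le_sum fun k _ => mul_le_mul_of_nonneg_left
    (sub_le_sub_right (mul_le_mul_of_nonneg_left h (Q.mu_pos k).le) _) (Nat.cast_nonneg _)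

theorem residual_eq_gain (d : ℕ → Fin K → ℕ) (η : ℝ) (G : ℕ → ℝ) (n : ℕ) :
    Q.residual d η G n = Q.h n - η + Q.lam * G (n + 1) - Q.gain (G n) (d n) := by
  simp only [residual, cost, rate, gain, mul_sub, Finset.sum_sub_distrib, Finset.sum_mul,
    mul_assoc]
  ring

theorem isFeasible_zero (n : ℕ) : Q.IsFeasible n 0 :=
  ⟨fun _ => Nat.zero_le _, by simp [total]⟩

theorem IsFeasible.mono {n n' : ℕ} {m : Fin K → ℕ} (h : Q.IsFeasible n m) (hn : n ≤ n') :
    Q.IsFeasible n' m :=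
  ⟨h.1, h.2.trans hn⟩

theorem isFeasible_single {k : Fin K} (hk : 0 < Q.M k) {n : ℕ} (hn : 0 < n) :
    Q.IsFeasible n (Pi.single k 1) := by
  refine ⟨fun j => ?_, by rw [total_single]; exact hn⟩
  by_cases h : j = k
  · subst h; rw [Pi.single_eq_same]; exact hk
  · simp [h]

theorem IsFeasible.eq_zero {m : Fin K → ℕ} (h : Q.IsFeasible 0 m) : m = 0 := by
  funext k
  have := h.2
  have h1 : m k ≤ total m := Finset.single_le_sum (fun _ _ => Nat.zero_le _) (Finset.mem_univ k)
  simp only [Pi.zero_apply]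
  omega

theorem gain_le_sum_abs {n : ℕ} {m : Fin K → ℕ} (h : Q.IsFeasible n m) (x : ℝ) :
    Q.gain x m ≤ ∑ k, (Q.M k : ℝ) * |Q.mu k * x - Q.c k| :=
  Finset.sum_le_sum fun k _ =>
    (mul_le_mul_of_nonneg_left (le_abs_self _) (Nat.cast_nonneg _)).trans
      (mul_le_mul_of_nonneg_right (Nat.cast_le.2 (h.1 k)) (abs_nonneg _))

theorem exists_max_gain (n : ℕ) (x : ℝ) :
    ∃ m, Q.IsFeasible n m ∧ ∀ m', Q.IsFeasible n m' → Q.gain x m' ≤ Q.gain x m := by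
  have hfin : {m | Q.IsFeasible n m}.Finite := (Set.finite_Iic Q.M).subset fun m hm => hm.1
  exact Set.exists_max_image _ (Q.gain x) hfin ⟨0, Q.isFeasible_zero n⟩

/-- The largest gain with `n` customers present. -/
noncomputable def maxGain (n : ℕ) (x : ℝ) : ℝ := Q.gain x (Q.exists_max_gain n x).choose

theorem gain_le_maxGain {n : ℕ} {m : Fin K → ℕ} (h : Q.IsFeasible n m) (x : ℝ) :
    Q.gain x m ≤ Q.maxGain n x :=
  (Q.exists_max_gain n x).choose_spec.2 m h

theorem exists_gain_eq_maxGain (n : ℕ) (x : ℝ) :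
    ∃ m, Q.IsFeasible n m ∧ Q.gain x m = Q.maxGain n x :=
  ⟨_, (Q.exists_max_gain n x).choose_spec.1, rfl⟩

theorem maxGain_mono (n : ℕ) {x y : ℝ} (h : y ≤ x) : Q.maxGain n y ≤ Q.maxGain n x := by
  obtain ⟨m, hm, he⟩ := Q.exists_gain_eq_maxGain n y
  rw [← he]
  exact (Q.gain_mono h m).trans (Q.gain_le_maxGain hm x)

theorem maxGain_zero (x : ℝ) : Q.maxGain 0 x = 0 := by
  obtain ⟨m, hm, he⟩ := Q.exists_gain_eq_maxGain 0 x
  rw [← he, hm.eq_zero, gain_zero]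

/-- The marginal gain from one more customer decreases in the number of customers and increases
in the value of a departure. -/
theorem maxGain_exchange (n : ℕ) {x y : ℝ} (h : y ≤ x) :
    Q.maxGain (n + 2) y + Q.maxGain n x ≤ Q.maxGain (n + 1) x + Q.maxGain (n + 1) y := by
  obtain ⟨p, hp, hpe⟩ := Q.exists_gain_eq_maxGain (n + 2) y
  obtain ⟨q, hq, hqe⟩ := Q.exists_gain_eq_maxGain n x
  rw [← hpe, ← hqe]
  by_cases hle : total p ≤ n + 1
  · have h1 := Q.gain_le_maxGain (n := n + 1) ⟨hp.1, hle⟩ y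
    have h2 := Q.gain_le_maxGain (hq.mono Q (Nat.le_succ n)) x
    linarith
  -- Exchange: `p` uses `n + 2` servers and `q` at most `n`, so one server of some group can move
  -- from `p` to `q`, where it earns `μ k * x - c k` instead of `μ k * y - c k`.
  · obtain ⟨k, -, hk⟩ : ∃ k ∈ Finset.univ, q k < p k :=
      Finset.exists_lt_of_sum_lt (lt_of_le_of_lt hq.2 (by simp only [total] at hle; omega))
    obtain ⟨p', rfl⟩ : ∃ p', p = p' + Pi.single k 1 := exists_eq_add_single (Nat.zero_lt_of_lt hk)
    have hp2 := hp.2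
    rw [total_add, total_single] at hp2
    have h1 : Q.IsFeasible (n + 1) p' :=
      ⟨fun j => le_trans (Nat.le_add_right _ _) (hp.1 j), by omega⟩
    have h2 : Q.IsFeasible (n + 1) (q + Pi.single k 1) := by
      refine ⟨fun j => ?_, by rw [total_add, total_single]; have := hq.2; omega⟩
      by_cases hj : j = k
      · subst hj
        have := hp.1 j
        simp only [Pi.add_apply, Pi.single_eq_same] at this hk ⊢
        omega
      · simpa [hj] using hq.1 j
    have h3 := Q.gain_le_maxGain h1 y
    have h4 := Q.gain_le_maxGain h2 x
    rw [gain_add, gain_single] at h4 ⊢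
    have := mul_le_mul_of_nonneg_left h (Q.mu_pos k).le
    linarith

section Maximizer

variable {n : ℕ} {x : ℝ} {m : Fin K → ℕ}

theorem eq_zero_of_maximal (hm : Q.IsFeasible n m)
    (hmax : ∀ m', Q.IsFeasible n m' → Q.gain x m' ≤ Q.gain x m) {k : Fin K}
    (hk : x < Q.c k / Q.mu k) : m k = 0 := by
  by_contra hne
  obtain ⟨p, rfl⟩ : ∃ p, m = p + Pi.single k 1 :=
    exists_eq_add_single (Nat.pos_of_ne_zero hne)
  have h1 := hmax p ⟨fun j => le_trans (Nat.le_add_right _ _) (hm.1 j), by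
    have := hm.2; rw [total_add] at this; omega⟩
  rw [gain_add, gain_single] at h1
  rw [lt_div_iff₀ (Q.mu_pos k)] at hk
  linarith

theorem total_le_of_eq_zero (hm : Q.IsFeasible n m) (p : Fin K → Prop) [DecidablePred p]
    (h : ∀ k, ¬ p k → m k = 0) : total m ≤ min n (∑ k with p k, Q.M k) := by
  refine le_min hm.2 ?_
  have : total m = ∑ k with p k, m k := by
    rw [total, Finset.sum_filter]
    refine Finset.sum_congr rfl fun k _ => ?_
    split_ifs with hk
    · rfl
    · exact h k hk
  rw [this]
  exact Finset.sum_le_sum fun k _ => hm.1 k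

theorem le_total_of_maximal (hm : Q.IsFeasible n m)
    (hmax : ∀ m', Q.IsFeasible n m' → Q.gain x m' ≤ Q.gain x m) :
    min n (∑ k with x > Q.c k / Q.mu k, Q.M k) ≤ total m := by
  by_contra! hlt
  obtain ⟨hn, hS⟩ := lt_min_iff.1 hlt
  have h1 : ∑ k with x > Q.c k / Q.mu k, m k ≤ total m :=
    Finset.sum_le_sum_of_subset (Finset.filter_subset _ _)
  obtain ⟨k, hk, hkM⟩ := Finset.exists_lt_of_sum_lt (h1.trans_lt hS)
  have hkx := (Finset.mem_filter.1 hk).2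
  have h2 := hmax (m + Pi.single k 1) ⟨fun j => by
    by_cases hj : j = k
    · subst hj; simpa using hkM
    · simpa [hj] using hm.1 j, by rw [total_add, total_single]; omega⟩
  rw [gain_add, gain_single] at h2
  rw [gt_iff_lt, div_lt_iff₀ (Q.mu_pos k)] at hkx
  linarith

end Maximizer

/-! ### The recursion for the realization factors -/

section Recursion

variable {η : ℝ} {G : ℕ → ℝ}

theorem not_eventually_gain_le (hrec : ∀ n, Q.lam * G (n + 1) = η - Q.h n + Q.gain (G n) (d n))
    (hG : ∀ᶠ n in atTop, 0 ≤ G n) (C : ℝ) : ¬ ∀ᶠ n in atTop, Q.gain (G n) (d n) ≤ C := by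
  intro h
  obtain ⟨n, h1, h2, h3⟩ := (h.and (((tendsto_add_atTop_nat 1).eventually hG).and
    (Q.h_tendsto.eventually_gt_atTop (η + C)))).exists
  have := hrec n
  have := mul_nonneg Q.lam_pos.le h2
  linarith

theorem gain_nonpos {κ : ℝ} (hκ : ∀ k, 0 < Q.M k → κ ≤ Q.c k / Q.mu k) {x : ℝ} (hx : x ≤ κ)
    {n : ℕ} {m : Fin K → ℕ} (hm : Q.IsFeasible n m) : Q.gain x m ≤ 0 := by
  refine Finset.sum_nonpos fun k _ => ?_
  rcases Nat.eq_zero_or_pos (m k) with h0 | h0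
  · simp [h0]
  · have h1 := hx.trans (hκ k (h0.trans_le (hm.1 k)))
    rw [le_div_iff₀ (Q.mu_pos k)] at h1
    exact mul_nonpos_of_nonneg_of_nonpos (Nat.cast_nonneg _) (by linarith)

/-- Once `G m ≤ κ`, no server is profitable and `h` only grows, so `G` stays below `κ` and the gain
nonpositive forever, which is impossible. -/
theorem lt_of_sub_le (hd : Q.IsEfficient d)
    (hrec : ∀ n, Q.lam * G (n + 1) = η - Q.h n + Q.gain (G n) (d n))
    (hG : ∀ᶠ n in atTop, 0 ≤ G n) {κ : ℝ} (hκ : ∀ k, 0 < Q.M k → κ ≤ Q.c k / Q.mu k) {m : ℕ}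
    (hm : η - Q.h m ≤ Q.lam * κ) : κ < G m := by
  by_contra! hle
  have h1 : ∀ n, m ≤ n → G n ≤ κ := by
    intro n hn
    induction n, hn using Nat.le_induction with
    | base => exact hle
    | succ n hn ih =>
      have := Q.gain_nonpos hκ ih (hd n)
      have := Q.h_mono hn
      refine le_of_mul_le_mul_left ?_ Q.lam_pos
      linarith [hrec n]
  exact Q.not_eventually_gain_le hrec hG 0
    (eventually_atTop.2 ⟨m, fun n hn => Q.gain_nonpos hκ (h1 n hn) (hd n)⟩)

theorem strictMono_of_recursion (hd : Q.IsEfficient d)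
    (hrec : ∀ n, Q.lam * G (n + 1) = η - Q.h n + Q.gain (G n) (d n))
    (hG : ∀ᶠ n in atTop, 0 ≤ G n) (hmax : ∀ n, Q.gain (G n) (d n) = Q.maxGain n (G n)) (n : ℕ) :
    G (n + 1) < G (n + 2) := by
  by_contra! hn
  obtain ⟨p, hp, hmin⟩ : ∃ p, G (p + 2) ≤ G (p + 1) ∧ ∀ q, q < p → G (q + 1) < G (q + 2) := by
    classical
    have hex : ∃ p, G (p + 2) ≤ G (p + 1) := ⟨n, hn⟩
    exact ⟨Nat.find hex, Nat.find_spec hex, fun q hq => not_le.1 (Nat.find_min hex hq)⟩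
  have hrec' : ∀ n, Q.lam * G (n + 1) = η - Q.h n + Q.maxGain n (G n) := fun n => by
    rw [hrec, hmax]
  have h0 : Q.maxGain p (G p) ≤ Q.maxGain p (G (p + 1)) := by
    cases p with
    | zero => rw [maxGain_zero, maxGain_zero]
    | succ p => exact Q.maxGain_mono _ (hmin p (by omega)).le
  -- The second clause carries the induction: the marginal gain of a customer falls with `q` and
  -- with `G`, whereas the increments of `h` do not fall.
  have key : ∀ q, p ≤ q → G (q + 2) ≤ G (q + 1) ∧
      Q.maxGain (q + 1) (G (q + 1)) - Q.maxGain q (G (q + 1)) ≤ Q.h (q + 1) - Q.h q := by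
    intro q hq
    induction q, hq using Nat.le_induction with
    | base =>
      refine ⟨hp, ?_⟩
      have h1 := hrec' p
      have h2 := hrec' (p + 1)
      have := mul_le_mul_of_nonneg_left hp Q.lam_pos.le
      linarith
    | succ q _ ih =>
      obtain ⟨ih1, ih2⟩ := ih
      have h1 := hrec' (q + 1)
      have h2 := hrec' (q + 2)
      have h3 := Q.maxGain_mono (q + 2) ih1
      have h4 := Q.maxGain_exchange q (le_refl (G (q + 1)))
      have h5 := Q.maxGain_exchange q ih1
      have h6 := Q.h_convex q
      constructor
      · refine le_of_mul_le_mul_left ?_ Q.lam_pos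
        change Q.lam * G (q + 2 + 1) ≤ Q.lam * G (q + 1 + 1)
        linarith
      · change Q.maxGain (q + 2) (G (q + 2)) - Q.maxGain (q + 1) (G (q + 2))
          ≤ Q.h (q + 2) - Q.h (q + 1)
        linarith
  have hbd : ∀ q, p + 1 ≤ q → G q ≤ G (p + 1) := by
    intro q hq
    induction q, hq using Nat.le_induction with
    | base => exact le_rfl
    | succ q hq ih =>
      obtain ⟨q, rfl⟩ : ∃ s, q = s + 1 := ⟨q - 1, by omega⟩
      exact (key q (by omega)).1.trans ih
  exact Q.not_eventually_gain_le hrec hG _ (eventually_atTop.2 ⟨p + 1, fun q hq =>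
    (Q.gain_mono (hbd q hq) _).trans (Q.gain_le_sum_abs (hd q) _)⟩)

end Recursion

/-! ### Consequences of optimality and conclusion -/

/-- The optimality equation, together with the strict monotonicity of the perturbation realization
factors. -/
theorem IsOptimal.maximal_and_strictMono {η : ℝ} {g : ℕ → ℝ} (hd : Q.IsOptimal d)
    (hη : Q.HasAverageCost d η) (hg : Q.IsPotential d η g) (hM : ∃ k, 0 < Q.M k) :
    (∀ n m, Q.IsFeasible n m → Q.gain (prf g n) m ≤ Q.gain (prf g n) (d n)) ∧
      ∀ n, prf g (n + 1) < prf g (n + 2) := by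
  obtain ⟨N, hN, hpos, hG, himp⟩ := hd.no_improvement Q hη hg
  have heff := hd.1
  obtain ⟨k, hk, hkmin⟩ := Finset.exists_min_image (Finset.univ.filter fun k => 0 < Q.M k)
    (fun k => Q.c k / Q.mu k) (by obtain ⟨k, hk⟩ := hM; exact ⟨k, by simpa using hk⟩)
  have hk0 : 0 < Q.M k := (Finset.mem_filter.1 hk).2
  set κ := Q.c k / Q.mu k with hκdef
  have hκ : ∀ j, 0 < Q.M j → κ ≤ Q.c j / Q.mu j := fun j hj => hkmin j (by simpa using hj)
  have hκk : Q.mu k * κ = Q.c k := mul_div_cancel₀ _ (Q.mu_pos k).ne'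
  have hres := fun n => (Q.residual_eq_gain d η (prf g) n).symm.trans (Q.residual_prf hg n)
  have hrec : ∀ n, Q.lam * prf g (n + 1) = η - Q.h n + Q.gain (prf g n) (d n) := fun n => by
    linarith [hres n]
  have hlamκ : ∀ n, η - Q.h n ≤ Q.lam * κ → κ < prf g n := fun n hn =>
    Q.lt_of_sub_le heff hrec hG hκ hn
  obtain rfl : N = 0 := by
    by_contra hne
    have hNrec : Q.lam * prf g (N + 1) = η - Q.h N := by
      rw [hrec, Q.eq_zero_of_rate_eq_zero hN, gain_zero, add_zero]
    have hlt : κ < prf g (N + 1) := by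
      by_contra! hle
      refine hle.not_gt (hlamκ _ ?_)
      have := mul_le_mul_of_nonneg_left hle Q.lam_pos.le
      linarith [Q.h_mono (Nat.le_succ N)]
    have hlt' := mul_lt_mul_of_pos_left hlt Q.lam_pos
    -- Let one server of the cheapest group work in states `1, …, N`. With `G' = κ` there its gain
    -- is zero, so the residual vanishes at `N` and, as `κ < G (N + 1)`, is negative below `N`.
    set d' : ℕ → Fin K → ℕ := fun n => if 0 < n ∧ n ≤ N then Pi.single k 1 else d n with hd'
    set G' : ℕ → ℝ := fun n => if n ≤ N then κ else prf g n with hG'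
    have hres' : ∀ n, Q.residual d' η G' n ≤ 0 ∧ (n < N → Q.residual d' η G' n < 0) := by
      intro n
      rw [residual_eq_gain]
      rcases lt_trichotomy n N with h | h | h
      · have h1 : G' n = κ := if_pos h.le
        have h2 : G' (n + 1) = κ := if_pos h
        have h3 : Q.gain κ (d' n) = 0 := by
          by_cases hn : 0 < n
          · rw [hd']
            simp only [hn, h.le, and_self, if_true]
            rw [gain_single, hκk, sub_self]
          · obtain rfl : n = 0 := by omega
            simp [hd', heff.zero, gain_zero]
        have h4 := Q.h_mono h.le
        rw [h1, h2, h3]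
        exact ⟨by linarith, fun _ => by linarith⟩
      · subst h
        have h1 : G' n = κ := if_pos le_rfl
        have h2 : G' (n + 1) = prf g (n + 1) := if_neg (by omega)
        have h3 : d' n = Pi.single k 1 := if_pos ⟨Nat.pos_of_ne_zero hne, le_rfl⟩
        rw [h1, h2, h3, gain_single]
        exact ⟨by linarith, fun hh => absurd hh (lt_irrefl _)⟩
      · have h1 : G' n = prf g n := if_neg (by omega)
        have h2 : G' (n + 1) = prf g (n + 1) := if_neg (by omega)
        have h3 : d' n = d n := if_neg (by omega)
        rw [h1, h2, h3]
        exact ⟨(hres n).le, fun hh => absurd hh (by omega)⟩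
    have h0 := himp d' G' N (fun n => ?_) (fun n hn => ?_) le_rfl
      (fun n hn => if_neg (by omega)) (fun n hn => if_neg (by omega)) (fun n => (hres' n).1) 0
    · exact h0.not_gt ((hres' 0).2 (Nat.pos_of_ne_zero hne))
    · by_cases h : 0 < n ∧ n ≤ N
      · simp only [hd', h, and_self, if_true]
        exact Q.isFeasible_single hk0 h.1
      · simp only [hd', h, if_false]
        exact heff n
    · by_cases h : 0 < n ∧ n ≤ N
      · simp only [hd', h, and_self, if_true, rate_single]
        exact Q.mu_pos k
      · simp only [hd', h, if_false]
        exact hpos n (by omega)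
  -- Change `d` in state `n` alone. A positive service rate keeps the competitor irreducible; the
  -- idle action is compared later, through the positive gain of a single cheapest server.
  have hactive : ∀ n m, 0 < n → Q.IsFeasible n m → 0 < Q.rate m →
      Q.gain (prf g n) m ≤ Q.gain (prf g n) (d n) := by
    intro n m hn hm hrate
    by_contra! hlt
    have hresu : ∀ j, Q.residual (Function.update d n m) η (prf g) j
        = if j = n then Q.gain (prf g n) (d n) - Q.gain (prf g n) m else 0 := by
      intro j
      rw [residual_eq_gain]
      split_ifs with hj
      · subst hj
        rw [Function.update_self]
        linarith [hres j]
      · rw [Function.update_of_ne hj]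
        exact hres j
    have h0 := himp (Function.update d n m) (prf g) n (fun j => ?_) (fun j hj => ?_)
      (Nat.zero_le n) (fun j hj => Function.update_of_ne (by omega) _ _) (fun _ _ => rfl)
      (fun j => ?_) n
    · rw [hresu, if_pos rfl] at h0
      linarith
    · by_cases hj : j = n
      · subst hj
        rw [Function.update_self]
        exact hm
      · rw [Function.update_of_ne hj]
        exact heff j
    · by_cases hj : j = n
      · subst hj
        rwa [Function.update_self]
      · rw [Function.update_of_ne hj]
        exact hpos _ (by omega)
    · rw [hresu]
      split_ifs
      · linarith
      · exact le_rfl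
  have hsingle : ∀ n, 0 < n → κ < prf g n → 0 < Q.gain (prf g n) (d n) := by
    intro n hn hκn
    have h1 := hactive n _ hn (Q.isFeasible_single hk0 hn)
      (by rw [rate_single]; exact Q.mu_pos k)
    rw [gain_single] at h1
    have := mul_lt_mul_of_pos_left hκn (Q.mu_pos k)
    linarith
  have hnext : ∀ n, 0 ≤ Q.gain (prf g n) (d n) → κ < prf g (n + 1) := by
    intro n h
    by_contra! hle
    refine hle.not_gt (hlamκ _ ?_)
    have := mul_le_mul_of_nonneg_left hle Q.lam_pos.le
    linarith [Q.h_mono (Nat.le_succ n), hrec n]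
  have hκlt : ∀ n, κ < prf g (n + 1) := by
    intro n
    induction n with
    | zero => exact hnext 0 (by rw [heff.zero, gain_zero])
    | succ n ih => exact hnext _ (hsingle _ (Nat.succ_pos n) ih).le
  have hmaximal : ∀ n m, Q.IsFeasible n m →
      Q.gain (prf g n) m ≤ Q.gain (prf g n) (d n) := by
    intro n m hm
    cases n with
    | zero => rw [hm.eq_zero, heff.zero]
    | succ n =>
      rcases (Q.rate_nonneg m).eq_or_lt with h | h
      · rw [Q.eq_zero_of_rate_eq_zero h.symm, gain_zero]
        exact (hsingle _ (Nat.succ_pos n) (hκlt n)).le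
      · exact hactive _ m (Nat.succ_pos n) hm h
  refine ⟨hmaximal, Q.strictMono_of_recursion heff hrec hG fun n => ?_⟩
  obtain ⟨m, hm, he⟩ := Q.exists_gain_eq_maxGain n (prf g n)
  exact le_antisymm (Q.gain_le_maxGain (heff n) _) (he ▸ hmaximal n m hm)

end GroupServerQueue

theorem theorem6 {K : ℕ} (Q : GroupServerQueue K) (d : ℕ → Fin K → ℕ) (η : ℝ) (g : ℕ → ℝ)
    (hd : Q.IsOptimal d) (hη : Q.HasAverageCost d η) (hg : Q.IsPotential d η g) :
    (∀ n, GroupServerQueue.total (d n) ≤ GroupServerQueue.total (d (n + 1))) ∧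
    (∀ n, (∀ k, GroupServerQueue.prf g n = Q.c k / Q.mu k → d n k = 0) →
      GroupServerQueue.total (d n) =
        min n (∑ k with GroupServerQueue.prf g n > Q.c k / Q.mu k, Q.M k)) ∧
    (∀ n,
      min n (∑ k with GroupServerQueue.prf g n > Q.c k / Q.mu k, Q.M k) ≤
        GroupServerQueue.total (d n) ∧
      GroupServerQueue.total (d n) ≤
        min n (∑ k with GroupServerQueue.prf g n ≥ Q.c k / Q.mu k, Q.M k)) := by
  by_cases hM : ∃ k, 0 < Q.M k
  · obtain ⟨hmax, hmono⟩ := hd.maximal_and_strictMono Q hη hg hM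
    have hlow := fun n => Q.le_total_of_maximal (hd.1 n) (hmax n)
    have hup := fun n => Q.total_le_of_eq_zero (hd.1 n)
      (fun k => GroupServerQueue.prf g n ≥ Q.c k / Q.mu k)
      fun k hk => Q.eq_zero_of_maximal (hd.1 n) (hmax n) (not_le.1 hk)
    refine ⟨fun n => ?_, fun n htie => ?_, fun n => ⟨hlow n, hup n⟩⟩
    · cases n with
      | zero => exact (hd.1 0).2.trans (Nat.zero_le _)
      | succ n =>
        -- Strict growth of `G` turns the weak inequality at `n + 1` into the strict one at `n + 2`,
        -- so ties need no separate treatment.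
        refine (hup (n + 1)).trans (le_trans ?_ (hlow (n + 2)))
        refine min_le_min (Nat.le_succ _) (Finset.sum_le_sum_of_subset fun k hk => ?_)
        rw [Finset.mem_filter] at hk ⊢
        exact ⟨hk.1, lt_of_le_of_lt hk.2 (hmono n)⟩
    · refine le_antisymm (Q.total_le_of_eq_zero (hd.1 n) _ fun k hk => ?_) (hlow n)
      rcases (not_lt.1 hk).lt_or_eq with h | h
      · exact Q.eq_zero_of_maximal (hd.1 n) (hmax n) h
      · exact htie k h
  · have hM0 : ∀ k, Q.M k = 0 := by simpa using hM
    have ht : ∀ n, GroupServerQueue.total (d n) = 0 := fun n =>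
      Finset.sum_eq_zero fun k _ => Nat.le_zero.1 (hM0 k ▸ (hd.1 n).1 k)
    simp [ht, hM0]
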